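/- Let $\ell$ and $p$ be distinct primes, let $\Lambda=\overline{\mathbb Q}_\ell$, let $n\ge 0$, and let $F$ be a $\mathbb Z_\ell$-linear automorphism of $\mathbb Z_\ell^n$ with standard basis $\gamma_1,\dots,\gamma_n$. Assume that for some integer $w>0$ every eigenvalue of $F$ in $\Lambda$ is a Weil number of weight $w$, i.e. an algebraic number $\alpha$ that is a unit at all nonarchimedean places outside $p$ and all of whose complex conjugates have absolute value $p^{w/2}$. (Example: $n=2\dim X$, $\mathbb Z_\ell^n\cong\pi_1(X)_\ell\cong H_1(X,\mathbb Z_\ell)$ for an abelian variety $X$ defined over a finite field $\kappa$ of characteristic $p$, and $F=F_\kappa$ the Frobenius.) Let $R_n=\Lambda\otimes_{\mathbb Z_\ell}\mathbb Z_\ell[[t_1,\dots,t_n]]$ and $m=(t_1,\dots,t_n)\subset R_n$. For $v\in\mathbb Z_\ell^n$ put $[v]=\prod_{j}(1+t_j)^{v_j}\in\mathbb Z_\ell[[t_1,\dots,t_n]]$. Let $F$ act on $R_n$ by the $\Lambda$-linear extension of the continuous ring automorphism of $\mathbb Z_\ell[[t_1,\dots,t_n]]$ with $1+t_i=[\gamma_i]\mapsto[F\gamma_i]$.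 Identify the $\Lambda$-valued points $\psi:R_n\to\Lambda$ of $\operatorname{Spec}(R_n)$ with the continuous characters $\chi:\mathbb Z_\ell^n\to\Lambda^*$ by $\chi(v)=\psi([v])$; these characters form a group under multiplication. Let $I\subset R_n$ be a prime ideal with $F(I)=I$ such that the trivial character is a point of $\operatorname{Spec}(R_n/I)$. Then either $I=m$, or there exists an infinite subset $A$ of the set of $\Lambda$-valued points of $\operatorname{Spec}(R_n/I)$ which, viewed as a set of characters, is a subgroup of the group of all continuous characters $\mathbb Z_\ell^n\to\Lambda^*$. -/

import Mathlib

open scoped TensorProduct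

noncomputable section

/-- `IsWeilNumber p w α`: the element `α` of a field of characteristic zero is a Weil number of
weight `w` (relative to the prime `p`), i.e. it is an algebraic number, it is a unit at all
nonarchimedean places outside `p` (both `α` and `α⁻¹` are integral over `ℤ[1/p]`), and all its
complex conjugates have absolute value `p ^ (w / 2)`. -/
def IsWeilNumber {K : Type*} [Field K] [CharZero K] (p w : ℕ) (α : K) : Prop :=
  IsAlgebraic ℚ α ∧
    (∃ k : ℕ, IsIntegral ℤ ((p : K) ^ k * α) ∧ IsIntegral ℤ ((p : K) ^ k * α⁻¹)) ∧
    ∀ z : ℂ, Polynomial.aeval z (minpoly ℚ α) = 0 → ‖z‖ = (p : ℝ) ^ ((w : ℝ) / 2)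

namespace CharacterTorus

variable (l : ℕ) [Fact l.Prime] (n : ℕ)

/-- The free `ℤ_l`-module `ℤ_l ^ n`, playing the role of the pro-`l` fundamental group. -/
abbrev Lattice : Type := Fin n → ℤ_[l]

/-- The coordinate ring `R_n = Λ ⊗ ℤ_l[[t_1, …, t_n]]`, the tensor product being taken
over `ℤ_l`, where `Λ` is the algebraic closure `PadicAlgCl l` of `ℚ_l`. -/
abbrev R : Type := PadicAlgCl l ⊗[ℤ_[l]] MvPowerSeries (Fin n) ℤ_[l]

/-- The group of characters: continuous homomorphisms from `ℤ_l ^ n` (written multiplicatively)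
to the unit group of `Λ`, the latter with its `l`-adic topology. It is an abelian group under
pointwise multiplication. -/
abbrev Character : Type := Multiplicative (Lattice l n) →ₜ* (PadicAlgCl l)ˣ

variable {l n}

/-- The group element `v ∈ ℤ_l ^ n`, viewed as the power series
`∏ j, (1 + t_j) ^ (v j)` in `ℤ_l[[t_1, …, t_n]]`: the coefficient of `∏ j, t_j ^ (d j)` is the
product of the binomial coefficients `(v j).choose (d j)`. -/
def groupLike (v : Lattice l n) : MvPowerSeries (Fin n) ℤ_[l] :=
  fun d => ∏ j, Ring.choose (v j) (d j)

theorem constantCoeff_groupLike (v : Lattice l n) :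
    MvPowerSeries.constantCoeff (groupLike v) = 1 := by
  rw [← MvPowerSeries.coeff_zero_eq_constantCoeff_apply]
  change ∏ j, Ring.choose (v j) ((0 : Fin n →₀ ℕ) j) = 1
  simp

/-- The series `[F e_i] - 1` can be substituted for the variables `t_i`. -/
theorem hasSubst_groupLike (F : Lattice l n →ₗ[ℤ_[l]] Lattice l n) :
    MvPowerSeries.HasSubst
      (fun i : Fin n => groupLike (F (Pi.single i 1)) - (1 : MvPowerSeries (Fin n) ℤ_[l])) :=
  MvPowerSeries.hasSubst_of_constantCoeff_zero fun i => by
    simp [constantCoeff_groupLike]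

/-- The ring endomorphism of `ℤ_l[[t_1, …, t_n]]` induced by an endomorphism `F` of `ℤ_l ^ n`:
the substitution `1 + t_i ↦ [F e_i]`, where `e_i` is the `i`-th basis vector. -/
def powerSeriesAction (F : Lattice l n →ₗ[ℤ_[l]] Lattice l n) :
    MvPowerSeries (Fin n) ℤ_[l] →ₐ[ℤ_[l]] MvPowerSeries (Fin n) ℤ_[l] :=
  MvPowerSeries.substAlgHom (hasSubst_groupLike F)

/-- The `Λ`-linear extension to `R_n` of the ring endomorphism induced by `F`. -/
def action (F : Lattice l n →ₗ[ℤ_[l]] Lattice l n) : R l n →ₐ[PadicAlgCl l] R l n :=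
  Algebra.TensorProduct.map (AlgHom.id (PadicAlgCl l) (PadicAlgCl l)) (powerSeriesAction F)

variable (l n) in
/-- The ideal `m = (t_1, …, t_n)` of `R_n`. -/
def maxIdeal : Ideal (R l n) :=
  Ideal.span (Set.range fun i : Fin n =>
    (1 : PadicAlgCl l) ⊗ₜ[ℤ_[l]] (MvPowerSeries.X i : MvPowerSeries (Fin n) ℤ_[l]))

/-- The `Λ`-valued point `ψ` of `Spec R_n` corresponds to the character `χ` if `ψ` maps (the image
in `R_n` of) each group element `v ∈ ℤ_l ^ n` to `χ v`. -/
def Corresponds (χ : Character l n) (ψ : R l n →ₐ[PadicAlgCl l] PadicAlgCl l) : Prop :=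
  ∀ v : Lattice l n, ψ (1 ⊗ₜ[ℤ_[l]] groupLike v) = (χ (Multiplicative.ofAdd v) : PadicAlgCl l)

/-- The set of `Λ`-valued points of `Spec (R_n / I)`, viewed as a set of characters. -/
def spectrumPoints (I : Ideal (R l n)) : Set (Character l n) :=
  {χ | ∃ ψ : R l n →ₐ[PadicAlgCl l] PadicAlgCl l, Corresponds χ ψ ∧ ∀ f ∈ I, ψ f = 0}

end CharacterTorus

end

/-! Near the trivial character use logarithmic coordinates `y_j`, with `t_j = exp (y_j s) - 1`. The
group element `[v]` becomes the exponential of a linear form, so `F` acts linearly on the `y_j` and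
respects the homogeneous components of each `f` in `R_n`. On forms of degree `d` the eigenvalues of
`F` are products of `d` eigenvalues of `F` on the lattice, hence of absolute value `p ^ (d w / 2)`
under a complex embedding. As `w > 0`, distinct degrees share no eigenvalue, and for given `f` and
`d` some polynomial in `F` kills the components of `f` below degree `d` and fixes the one in degree
`d`. Thus every homogeneous component of an element of `I` is the leading form of an element of `I`
(`exists_isolate_logComponent`).

Now consider the tangent cone of `I` at the trivial character. If it is at most the origin, the
Nullstellensatz gives `m ^ M ≤ I + m ^ (M + 1)`, and Nakayama with primality gives `m ≤ I`
(`maxIdeal_le_of_X_mem_radical`). Otherwise it contains some `a ≠ 0`. All components of all elements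
of `I` vanish at `a`, hence on the line through `a`. Once `a` is scaled so that the exponentials
converge, the characters `v ↦ exp (k ∑ v_j a_j)` with `k` an integer are points of `Spec (R_n / I)`
(`exists_infinite_subgroup`). They form an infinite cyclic group because `exp` takes the value `1`
only at `0` near the origin. -/

noncomputable section

namespace CharacterTorus

variable {l : ℕ} [Fact l.Prime] {n : ℕ}

/-! ### Exponential substitution in power series -/

section ExpHom

variable {B : Type*} [CommRing B] [Algebra ℚ B] [Algebra ℤ_[l] B]

/-- The power series `exp (y s) - 1`. -/
def expSubOne (y : B) : PowerSeries B := PowerSeries.rescale y (PowerSeries.exp B) - 1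

theorem constantCoeff_expSubOne (y : B) : PowerSeries.constantCoeff (expSubOne y) = 0 := by
  rw [expSubOne, map_sub, ← PowerSeries.coeff_zero_eq_constantCoeff_apply,
    PowerSeries.coeff_rescale]
  simp

theorem coeff_one_expSubOne (y : B) : PowerSeries.coeff 1 (expSubOne y) = y := by
  simp [expSubOne, PowerSeries.coeff_rescale, PowerSeries.coeff_exp, PowerSeries.coeff_one]

theorem X_pow_dvd_prod_expSubOne (y : Fin n → B) (e : Fin n →₀ ℕ) :
    (PowerSeries.X : PowerSeries B) ^ e.degree ∣ e.prod fun j k => expSubOne (y j) ^ k := by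
  rw [Finsupp.prod_fintype _ _ (by simp), Finsupp.degree_eq_sum, ← Finset.prod_pow_eq_pow_sum]
  exact Finset.prod_dvd_prod_of_dvd _ _ fun j _ =>
    pow_dvd_pow_of_dvd (PowerSeries.X_dvd_iff.2 (constantCoeff_expSubOne _)) _

theorem coeff_prod_expSubOne_eq_zero (y : Fin n → B) (e : Fin n →₀ ℕ) {d : ℕ}
    (h : d < e.degree) :
    PowerSeries.coeff d (e.prod fun j k => expSubOne (y j) ^ k) = 0 :=
  PowerSeries.X_pow_dvd_iff.1 (X_pow_dvd_prod_expSubOne y e) d h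

theorem hasSubst_expSubOne (y : Fin n → B) :
    MvPowerSeries.HasSubst (fun j => (expSubOne (y j) : MvPowerSeries Unit B)) :=
  MvPowerSeries.hasSubst_of_constantCoeff_zero fun j => constantCoeff_expSubOne (y j)

/-- The substitution `t_j ↦ exp (y_j s) - 1`. -/
def expHom (y : Fin n → B) : MvPowerSeries (Fin n) ℤ_[l] →ₐ[ℤ_[l]] PowerSeries B :=
  MvPowerSeries.substAlgHom (hasSubst_expSubOne y)

/-- Each `exp (y_j s) - 1` has order at least one in `s`, so only exponents in a finite box
contribute. The finite sum is what later arguments on homogeneity, norms and base change work with.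
-/
theorem coeff_expHom (y : Fin n → B) (f : MvPowerSeries (Fin n) ℤ_[l]) {d M : ℕ} (hM : d ≤ M) :
    PowerSeries.coeff d (expHom y f) = ∑ e ∈ Finset.Iic (Finsupp.equivFunOnFinite.symm fun _ => M),
      MvPowerSeries.coeff e f •
        PowerSeries.coeff d (e.prod fun j k => expSubOne (y j) ^ k) := by
  have h := MvPowerSeries.coeff_subst (hasSubst_expSubOne y) f (Finsupp.single () d)
  rw [finsum_eq_sum_of_support_subset] at h
  · rw [expHom, MvPowerSeries.substAlgHom_apply]
    exact h
  · intro e he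
    rw [Finset.mem_coe, Finset.mem_Iic]
    intro j
    by_contra hj
    apply he
    have : d < e.degree := by
      refine lt_of_le_of_lt hM (lt_of_lt_of_le (not_le.1 hj) (Finsupp.le_degree j e))
    have h2 := coeff_prod_expSubOne_eq_zero y e this
    show _ • PowerSeries.coeff d _ = _
    rw [h2, smul_zero]

theorem expHom_X (y : Fin n → B) (j : Fin n) :
    expHom (l := l) y (MvPowerSeries.X j) = expSubOne (y j) := by
  rw [expHom, MvPowerSeries.substAlgHom_X]

/-- Over a `ℚ`-algebra the binomial coefficient is a polynomial function of `r`; this is what makes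
the density argument of `expHom_groupLike` possible. -/
theorem algebraMap_choose (r : ℤ_[l]) (k : ℕ) :
    algebraMap ℤ_[l] B (Ring.choose r k) =
      algebraMap ℚ B (1 / k.factorial) * (descPochhammer B k).eval (algebraMap ℤ_[l] B r) := by
  have h := congrArg (algebraMap ℤ_[l] B) (Ring.descPochhammer_eq_factorial_smul_choose r k)
  rw [nsmul_eq_mul, map_mul, map_natCast] at h
  have h2 : algebraMap ℤ_[l] B (Polynomial.smeval (descPochhammer ℤ k) r) =
      (descPochhammer B k).eval (algebraMap ℤ_[l] B r) := by
    rw [← descPochhammer_map (Int.castRingHom B), Polynomial.eval_map,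
      Polynomial.smeval_eq_sum, Polynomial.eval₂_eq_sum, Polynomial.sum, Polynomial.sum, map_sum]
    simp [Polynomial.smul_pow]
  rw [← h2, h, ← map_natCast (algebraMap ℚ B), ← mul_assoc, ← map_mul]
  have : (k.factorial : ℚ) ≠ 0 := by positivity
  simp [this]

theorem rescale_exp_pow (y : B) (k : ℕ) :
    PowerSeries.rescale y (PowerSeries.exp B) ^ k =
      PowerSeries.rescale (k * y) (PowerSeries.exp B) := by
  rw [← map_pow, PowerSeries.exp_pow_eq_rescale_exp, PowerSeries.rescale_rescale]

theorem prod_rescale_exp {ι : Type*} (s : Finset ι) (y : ι → B) :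
    ∏ j ∈ s, PowerSeries.rescale (y j) (PowerSeries.exp B) =
      PowerSeries.rescale (∑ j ∈ s, y j) (PowerSeries.exp B) := by
  classical
  induction s using Finset.induction_on with
  | empty => simp
  | insert a s ha ih =>
    rw [Finset.prod_insert ha, Finset.sum_insert ha, ih, PowerSeries.exp_mul_exp_eq_exp_add]

theorem sum_choose_mul_expSubOne_pow (y : B) {v M : ℕ} (h : v ≤ M) :
    ∑ k ∈ Finset.range (M + 1), (v.choose k : PowerSeries B) * expSubOne y ^ k =
      PowerSeries.rescale (v * y) (PowerSeries.exp B) := by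
  have h1 : PowerSeries.rescale y (PowerSeries.exp B) = expSubOne y + 1 := by
    simp [expSubOne]
  rw [← rescale_exp_pow, h1, add_pow]
  symm
  refine (Finset.sum_congr rfl fun k _ => ?_).trans
    (Finset.sum_subset (Finset.range_mono (Nat.succ_le_succ h)) ?_)
  · rw [one_pow, mul_one, mul_comm]
  · intro k _ hk
    rw [Nat.choose_eq_zero_of_lt (by simpa using hk)]
    simp

/-- For natural exponents this is the binomial theorem for `(1 + (exp (y_j s) - 1)) ^ v_j`,
multiplied over `j`. The box is enlarged from `d` to some `M ≥ v_j` so that the binomial sums are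
complete; the added terms have order greater than `d`. -/
theorem coeff_prod_choose_natCast (y : Fin n → B) (v : Fin n → ℕ) (d : ℕ) :
    ∑ e ∈ Finset.Iic (Finsupp.equivFunOnFinite.symm fun _ => d),
      (∏ j, ((v j).choose (e j) : B)) *
        PowerSeries.coeff d (e.prod fun j k => expSubOne (y j) ^ k) =
      algebraMap ℚ B (1 / d.factorial) * (∑ j, (v j : B) * y j) ^ d := by
  obtain ⟨M, hdM, hvM⟩ : ∃ M, d ≤ M ∧ ∀ j, v j ≤ M :=
    ⟨d + ∑ j, v j, Nat.le_add_right _ _, fun j =>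
      (Finset.single_le_sum (fun _ _ => Nat.zero_le _) (Finset.mem_univ j)).trans
        (Nat.le_add_left _ _)⟩
  have h1 : ∑ e ∈ Finset.Iic (Finsupp.equivFunOnFinite.symm fun _ : Fin n => d),
      (∏ j, ((v j).choose (e j) : B)) *
        PowerSeries.coeff d (e.prod fun j k => expSubOne (y j) ^ k) =
      ∑ e ∈ Finset.Iic (Finsupp.equivFunOnFinite.symm fun _ : Fin n => M),
      (∏ j, ((v j).choose (e j) : B)) *
        PowerSeries.coeff d (e.prod fun j k => expSubOne (y j) ^ k) := by
    refine Finset.sum_subset (Finset.Iic_subset_Iic.2 fun j => hdM) fun e _ he => ?_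
    rw [Finset.mem_Iic, Finsupp.le_def, not_forall] at he
    obtain ⟨j, hj⟩ := he
    rw [coeff_prod_expSubOne_eq_zero y e (d := d)
      (lt_of_lt_of_le (not_le.1 hj) (Finsupp.le_degree j e)), mul_zero]
  have h2 := Finset.prod_univ_sum (fun _ : Fin n => Finset.range (M + 1))
    (fun j k => ((v j).choose k : PowerSeries B) * expSubOne (y j) ^ k)
  rw [Finset.prod_congr rfl fun j _ => sum_choose_mul_expSubOne_pow (y j) (hvM j),
    prod_rescale_exp] at h2
  have h3 := congrArg (PowerSeries.coeff d) h2
  rw [PowerSeries.coeff_rescale, PowerSeries.coeff_exp, map_sum] at h3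
  rw [h1, mul_comm, h3]
  refine Finset.sum_equiv Finsupp.equivFunOnFinite ?_ ?_
  · intro e
    simp [Finsupp.le_def]
  · intro e _
    rw [Finset.prod_mul_distrib, Finsupp.prod_fintype _ _ (by simp),
      ← PowerSeries.coeff_C_mul]
    simp

/-- Each coefficient of either side is a polynomial in `v`. The two polynomials `P` and `Q` agree on
`ℕ ^ n`, which is Zariski dense over a domain of characteristic zero. -/
theorem expHom_groupLike [IsDomain B] (y : Fin n → B) (v : Lattice l n) :
    expHom y (groupLike v) =
      PowerSeries.rescale (∑ j, v j • y j) (PowerSeries.exp B) := by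
  have : CharZero B := algebraRat.charZero B
  ext d
  rw [coeff_expHom y _ le_rfl]
  let P : MvPolynomial (Fin n) B :=
    ∑ e ∈ Finset.Iic (Finsupp.equivFunOnFinite.symm fun _ => d),
      (∏ j, MvPolynomial.C (algebraMap ℚ B (1 / (e j).factorial)) *
        Polynomial.aeval (MvPolynomial.X j) (descPochhammer B (e j))) *
      MvPolynomial.C (PowerSeries.coeff d (e.prod fun j k => expSubOne (y j) ^ k))
  let Q : MvPolynomial (Fin n) B :=
    MvPolynomial.C (algebraMap ℚ B (1 / d.factorial)) *
      (∑ j, MvPolynomial.X j * MvPolynomial.C (y j)) ^ d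
  have haev : ∀ (x : Fin n → B) (j : Fin n) (k : ℕ),
      MvPolynomial.eval x (Polynomial.aeval (MvPolynomial.X j) (descPochhammer B k)) =
        (descPochhammer B k).eval (x j) := by
    intro x j k
    rw [Polynomial.aeval_def, Polynomial.hom_eval₂, MvPolynomial.eval_X]
    have : (MvPolynomial.eval x).comp (algebraMap B (MvPolynomial (Fin n) B)) =
        RingHom.id B := by ext b; simp [MvPolynomial.algebraMap_eq]
    rw [this, Polynomial.eval₂_id]
  have hPQ : P = Q := by
    refine MvPolynomial.funext_set (fun _ => Set.range (Nat.cast : ℕ → B))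
      (fun _ => Set.infinite_range_of_injective Nat.cast_injective) ?_
    intro x hx
    have hx' : ∀ j, ∃ k : ℕ, (k : B) = x j := fun j => hx j (Set.mem_univ j)
    choose w hw using hx'
    have := coeff_prod_choose_natCast y w d
    simp only [P, Q, map_sum, map_mul, map_prod, map_pow, MvPolynomial.eval_C, haev,
      MvPolynomial.eval_X, ← hw]
    rw [← this]
    refine Finset.sum_congr rfl fun e _ => ?_
    congr 1
    refine Finset.prod_congr rfl fun j _ => ?_
    have h3 := algebraMap_choose (l := l) (B := B) (w j : ℤ_[l]) (e j)
    rw [map_natCast, Ring.choose_natCast, map_natCast] at h3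
    exact h3.symm
  have := congrArg (MvPolynomial.eval fun j => algebraMap ℤ_[l] B (v j)) hPQ
  simp only [P, Q, map_sum, map_mul, map_prod, map_pow, MvPolynomial.eval_C, haev,
      MvPolynomial.eval_X, ← algebraMap_choose] at this
  simp only [PowerSeries.coeff_rescale, PowerSeries.coeff_exp, Algebra.smul_def]
  rw [mul_comm _ (algebraMap ℚ B _), ← this]
  refine Finset.sum_congr rfl fun e _ => ?_
  rw [← map_prod]
  rfl

theorem map_expSubOne {B' : Type*} [CommRing B'] [Algebra ℚ B'] (h : B →+* B') (y : B) :
    PowerSeries.map h (expSubOne y) = expSubOne (h y) := by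
  ext d
  simp [expSubOne, PowerSeries.coeff_rescale, PowerSeries.coeff_exp, PowerSeries.coeff_one]

/-- Naturality in `B` serves twice: to specialize the universal coordinates to a point, and to see
that coefficients stay in the field generated by that point. -/
theorem map_expHom {B' : Type*} [CommRing B'] [Algebra ℚ B'] [Algebra ℤ_[l] B']
    (h : B →ₐ[ℤ_[l]] B') (y : Fin n → B) (f : MvPowerSeries (Fin n) ℤ_[l]) :
    PowerSeries.map (h : B →+* B') (expHom y f) = expHom (fun j => h (y j)) f := by
  ext d
  rw [PowerSeries.coeff_map, coeff_expHom y f le_rfl, coeff_expHom _ f le_rfl, map_sum]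
  refine Finset.sum_congr rfl fun e _ => ?_
  rw [Algebra.smul_def, map_mul, Algebra.smul_def, ← PowerSeries.coeff_map,
    Finsupp.prod, map_prod]
  simp [map_expSubOne, Finsupp.prod]

theorem expHom_powerSeriesAction [IsDomain B] (y : Fin n → B)
    (F : Lattice l n →ₗ[ℤ_[l]] Lattice l n) (f : MvPowerSeries (Fin n) ℤ_[l]) :
    expHom y (powerSeriesAction F f) =
      expHom (fun i => ∑ j, F (Pi.single i 1) j • y j) f := by
  have h := MvPowerSeries.substAlgHom_comp_substAlgHom_apply (hasSubst_groupLike F)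
    (hasSubst_expSubOne y) f
  rw [expHom, powerSeriesAction, h]
  rw [expHom, MvPowerSeries.substAlgHom_apply, MvPowerSeries.substAlgHom_apply]
  congr 1
  funext i
  rw [map_sub, map_one]
  change expHom y _ - 1 = _
  rw [expHom_groupLike, expSubOne]

end ExpHom

end CharacterTorus

end

/-! ### Homogeneous components in logarithmic coordinates -/

noncomputable section

namespace CharacterTorus

variable {l : ℕ} [Fact l.Prime] {n : ℕ}

section ExpLift

variable {B : Type*} [CommRing B] [Algebra ℚ B] [Algebra ℤ_[l] B] [Algebra (PadicAlgCl l) B]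
  [IsScalarTower ℤ_[l] (PadicAlgCl l) B]

/-- The `Λ`-linear extension to `R_n` of the substitution `t_j ↦ exp (y_j s) - 1`. -/
def expLift (y : Fin n → B) : R l n →ₐ[PadicAlgCl l] PowerSeries B :=
  Algebra.TensorProduct.lift (Algebra.ofId (PadicAlgCl l) (PowerSeries B)) (expHom y)
    fun _ _ => Commute.all _ _

theorem expLift_tmul (y : Fin n → B) (c : PadicAlgCl l) (f : MvPowerSeries (Fin n) ℤ_[l]) :
    expLift y (c ⊗ₜ f) = c • expHom y f := by
  rw [expLift, Algebra.TensorProduct.lift_tmul, Algebra.smul_def]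
  rfl

theorem map_expLift {B' : Type*} [CommRing B'] [Algebra ℚ B'] [Algebra ℤ_[l] B']
    [Algebra (PadicAlgCl l) B'] [IsScalarTower ℤ_[l] (PadicAlgCl l) B']
    (h : B →ₐ[PadicAlgCl l] B') (y : Fin n → B) (f : R l n) :
    PowerSeries.map (h : B →+* B') (expLift y f) = expLift (fun j => h (y j)) f := by
  induction f using TensorProduct.induction_on with
  | zero => simp
  | add f g hf hg => simp only [map_add, hf, hg]
  | tmul c f =>
    have h2 := map_expHom (h.restrictScalars ℤ_[l]) y f
    simp only [AlgHom.coe_restrictScalars'] at h2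
    rw [expLift_tmul, expLift_tmul, ← h2]
    ext d
    simp

theorem expLift_action [IsDomain B] (y : Fin n → B) (F : Lattice l n →ₗ[ℤ_[l]] Lattice l n)
    (f : R l n) :
    expLift y (action F f) = expLift (fun i => ∑ j, F (Pi.single i 1) j • y j) f := by
  induction f using TensorProduct.induction_on with
  | zero => simp
  | add f g hf hg => simp only [map_add, hf, hg]
  | tmul c f =>
    rw [action, Algebra.TensorProduct.map_tmul, expLift_tmul, expLift_tmul,
      expHom_powerSeriesAction]
    rfl

end ExpLift

/-- The expansion of an element of `R_n` in homogeneous polynomials in the logarithmic coordinates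
at the trivial character, as a power series in an auxiliary grading variable. -/
def logExpansion : R l n →ₐ[PadicAlgCl l] PowerSeries (MvPolynomial (Fin n) (PadicAlgCl l)) :=
  expLift MvPolynomial.X

/-- The homogeneous component of degree `d` in the logarithmic coordinates. -/
def logComponent (d : ℕ) : R l n →ₗ[PadicAlgCl l] MvPolynomial (Fin n) (PadicAlgCl l) :=
  (PowerSeries.coeff d).restrictScalars (PadicAlgCl l) ∘ₗ logExpansion.toLinearMap

theorem logComponent_apply (d : ℕ) (f : R l n) :
    logComponent d f = PowerSeries.coeff d (logExpansion f) := rfl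

theorem map_aeval_logExpansion (a : Fin n → PadicAlgCl l) (f : R l n) :
    PowerSeries.map ((MvPolynomial.aeval a : _ →ₐ[PadicAlgCl l] PadicAlgCl l) : _ →+* _)
      (logExpansion f) = expLift a f := by
  rw [logExpansion, map_expLift]
  simp

/-- Restricting `f` to the curve `s ↦ exp (s a)` recovers the values at `a` of all its homogeneous
components. -/
theorem coeff_expLift (a : Fin n → PadicAlgCl l) (f : R l n) (d : ℕ) :
    PowerSeries.coeff d (expLift a f) = MvPolynomial.aeval a (logComponent d f) := by
  rw [← map_aeval_logExpansion, PowerSeries.coeff_map]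
  rfl

/-- Power series over a polynomial ring whose coefficient of degree `d` is homogeneous of
degree `d`. -/
def homogeneousSeries (σ A : Type*) [CommRing A] :
    Submonoid (PowerSeries (MvPolynomial σ A)) where
  carrier := {p | ∀ d, (PowerSeries.coeff d p).IsHomogeneous d}
  one_mem' d := by
    rw [PowerSeries.coeff_one]
    split_ifs with h
    · subst h; exact MvPolynomial.isHomogeneous_one _ _
    · exact MvPolynomial.isHomogeneous_zero _ _ _
  mul_mem' {p q} hp hq d := by
    rw [PowerSeries.coeff_mul]
    refine MvPolynomial.IsHomogeneous.sum _ _ _ fun x hx => ?_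
    rw [← Finset.HasAntidiagonal.mem_antidiagonal.1 hx]
    exact (hp _).mul (hq _)

theorem expSubOne_mem_homogeneousSeries (i : Fin n) :
    expSubOne (MvPolynomial.X i) ∈ homogeneousSeries (Fin n) (PadicAlgCl l) := by
  intro d
  rw [expSubOne, map_sub]
  refine MvPolynomial.IsHomogeneous.sub ?_ ((homogeneousSeries _ _).one_mem d)
  rw [PowerSeries.coeff_rescale, PowerSeries.coeff_exp,
    IsScalarTower.algebraMap_apply ℚ (PadicAlgCl l), MvPolynomial.algebraMap_eq]
  have := ((MvPolynomial.isHomogeneous_X (PadicAlgCl l) i).pow d).mul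
    (MvPolynomial.isHomogeneous_C (Fin n) (algebraMap ℚ (PadicAlgCl l) (1 / d.factorial)))
  simpa using this

theorem isHomogeneous_logComponent (d : ℕ) (f : R l n) : (logComponent d f).IsHomogeneous d := by
  induction f using TensorProduct.induction_on with
  | zero => rw [map_zero]; exact MvPolynomial.isHomogeneous_zero _ _ _
  | add f g hf hg => rw [map_add]; exact hf.add hg
  | tmul c f =>
    rw [logComponent_apply, logExpansion, expLift_tmul, PowerSeries.coeff_smul,
      coeff_expHom _ _ le_rfl]
    refine (MvPolynomial.homogeneousSubmodule (Fin n) (PadicAlgCl l) d).smul_mem _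
      (Submodule.sum_mem _ fun e _ => ?_)
    rw [← algebraMap_smul (PadicAlgCl l)]
    refine Submodule.smul_mem _ _ ?_
    exact Submonoid.prod_mem (homogeneousSeries _ _)
      (fun j _ => pow_mem (expSubOne_mem_homogeneousSeries j) _) d

/-- The action of `F` on polynomials in the logarithmic coordinates. -/
def polynomialAction (F : Lattice l n →ₗ[ℤ_[l]] Lattice l n) :
    MvPolynomial (Fin n) (PadicAlgCl l) →ₐ[PadicAlgCl l] MvPolynomial (Fin n) (PadicAlgCl l) :=
  MvPolynomial.aeval fun i => ∑ j, F (Pi.single i 1) j • MvPolynomial.X j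

theorem logComponent_action (F : Lattice l n →ₗ[ℤ_[l]] Lattice l n) (d : ℕ) (f : R l n) :
    logComponent d (action F f) = polynomialAction F (logComponent d f) := by
  rw [logComponent_apply, logExpansion, expLift_action, logComponent_apply]
  have h := map_expLift (polynomialAction F) (MvPolynomial.X : Fin n → _) f
  have h2 : (fun j => polynomialAction F (MvPolynomial.X j)) =
      fun i => ∑ j, F (Pi.single i 1) j • MvPolynomial.X j := by
    funext i; simp [polynomialAction]
  rw [h2] at h
  rw [← h]
  simp [logExpansion]

end CharacterTorus

end

/-! ### Generalized eigenspaces graded by weight -/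

noncomputable section

/-- A family of sets of scalars that behaves like the sets of numbers of a given weight:
it is multiplicative, and distinct weights are disjoint. -/
structure WeightSystem (k : Type*) [Field k] where
  /-- The scalars of a given weight. -/
  weight : ℕ → Set k
  one_mem : 1 ∈ weight 0
  mul_mem : ∀ {d e : ℕ} {μ ν : k}, μ ∈ weight d → ν ∈ weight e → μ * ν ∈ weight (d + e)
  disjoint : ∀ {d e : ℕ} {μ : k}, μ ∈ weight d → μ ∈ weight e → d = e

namespace WeightSystem

variable {k : Type*} [Field k] (W : WeightSystem k)

section Module

variable {E : Type*} [AddCommGroup E] [Module k E]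

/-- The sum of the generalized eigenspaces with eigenvalues of weight `d`. -/
def genSpace (τ : Module.End k E) (d : ℕ) : Submodule k E :=
  ⨆ μ ∈ W.weight d, τ.maxGenEigenspace μ

theorem maxGenEigenspace_le_genSpace (τ : Module.End k E) {d : ℕ} {μ : k}
    (hμ : μ ∈ W.weight d) : τ.maxGenEigenspace μ ≤ W.genSpace τ d :=
  le_iSup₂_of_le μ hμ le_rfl

/-- A vector of the sum is a finite sum of generalized eigenvectors, and the product of their
annihilators has only roots of weight `d`. Working vector by vector avoids any finiteness assumption
on `E`. -/
theorem exists_annihilator (τ : Module.End k E) {d : ℕ} {f : E} (hf : f ∈ W.genSpace τ d) :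
    ∃ q : Polynomial k, q ≠ 0 ∧ (∀ μ, q.IsRoot μ → μ ∈ W.weight d) ∧
      Polynomial.aeval τ q f = 0 := by
  rw [genSpace, iSup_subtype'] at hf
  induction hf using Submodule.iSup_induction' with
  | mem μ x hx =>
    obtain ⟨m, hm⟩ := (Module.End.mem_maxGenEigenspace _ _ _).1 hx
    refine ⟨(Polynomial.X - Polynomial.C μ.1) ^ m,
      pow_ne_zero _ (Polynomial.X_sub_C_ne_zero _), fun ν hν => ?_, ?_⟩
    · have h1 : (ν - μ.1) ^ m = 0 := by simpa [Polynomial.IsRoot] using hν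
      rw [sub_eq_zero.1 (eq_zero_of_pow_eq_zero h1)]
      exact μ.2
    · rw [← hm, map_pow, map_sub, Polynomial.aeval_X, Polynomial.aeval_C]
      rfl
  | zero => exact ⟨1, one_ne_zero, fun μ hμ => by simp [Polynomial.IsRoot] at hμ, map_zero _⟩
  | add x y _ _ hx hy =>
    obtain ⟨p, hp0, hp, hpx⟩ := hx
    obtain ⟨q, hq0, hq, hqx⟩ := hy
    refine ⟨p * q, mul_ne_zero hp0 hq0, fun μ hμ => ?_, ?_⟩
    · rw [Polynomial.root_mul] at hμ
      exact hμ.elim (hp μ) (hq μ)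
    · rw [map_add, map_mul, Module.End.mul_apply, Module.End.mul_apply, hqx, map_zero,
        add_zero, ← Module.End.mul_apply, ← map_mul, mul_comm, map_mul, Module.End.mul_apply, hpx,
        map_zero]

variable {M : Type*} [AddCommGroup M] [Module k M]

theorem aeval_apply_intertwine {A : Module.End k M} {τ : Module.End k E} {c : M →ₗ[k] E}
    (h : ∀ x, c (A x) = τ (c x)) (r : Polynomial k) (x : M) :
    c (Polynomial.aeval A r x) = Polynomial.aeval τ r (c x) := by
  induction r using Polynomial.induction_on' with
  | add p q hp hq => simp [hp, hq]
  | monomial m a =>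
    have : c ((A ^ m) x) = (τ ^ m) (c x) := by
      induction m with
      | zero => simp
      | succ m ih => rw [pow_succ', pow_succ', Module.End.mul_apply, Module.End.mul_apply, h, ih]
    simp [Polynomial.aeval_monomial, this]

/-- Let `q e` annihilate `c e x`, with roots of weight `e`. Then `q d` and the product of the `q e`
for `e < d` have no common root, and a Bézout relation supplies the polynomial in `A` to apply to
`x`. -/
theorem exists_isolate_component [IsAlgClosed k] {A : Module.End k M} {τ : Module.End k E}
    {c : ℕ → M →ₗ[k] E} (h : ∀ e x, c e (A x) = τ (c e x))
    (hc : ∀ e x, c e x ∈ W.genSpace τ e) {I : Submodule k M} (hI : ∀ x ∈ I, A x ∈ I)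
    {x : M} (hx : x ∈ I) (d : ℕ) :
    ∃ y ∈ I, c d y = c d x ∧ ∀ e < d, c e y = 0 := by
  choose q hq0 hq hqx using fun e => W.exists_annihilator τ (hc e x)
  have hcop : IsCoprime (q d) (∏ e ∈ Finset.range d, q e) := by
    refine IsCoprime.prod_right fun e he => ?_
    rw [Polynomial.isCoprime_iff_aeval_ne_zero_of_isAlgClosed k k]
    intro μ
    by_contra! hcon
    rw [Polynomial.coe_aeval_eq_eval] at hcon
    exact absurd (W.disjoint (hq d μ hcon.1) (hq e μ hcon.2))
      (Finset.mem_range.1 he).ne'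
  obtain ⟨u, v, huv⟩ := hcop
  refine ⟨Polynomial.aeval A (v * ∏ e ∈ Finset.range d, q e) x, ?_, ?_, fun e he => ?_⟩
  · generalize v * ∏ e ∈ Finset.range d, q e = r
    induction r using Polynomial.induction_on' with
    | add p q hp hq => simpa using I.add_mem hp hq
    | monomial m a =>
      have : (A ^ m) x ∈ I := by
        induction m with
        | zero => simpa
        | succ m ih => rw [pow_succ', Module.End.mul_apply]; exact hI _ ih
      simpa [Polynomial.aeval_monomial] using I.smul_mem a this
  -- The polynomial equals `1 - u * q d`, which acts on `c d x` as the identity.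
  · rw [aeval_apply_intertwine (h d), eq_sub_of_add_eq' huv]
    simp [hqx]
  · rw [aeval_apply_intertwine (h e), ← Finset.mul_prod_erase _ _ (Finset.mem_range.2 he),
      mul_left_comm, mul_comm, map_mul, Module.End.mul_apply, hqx, map_zero]

end Module

section Algebra

variable {E : Type*} [CommRing E] [Algebra k E]

/-- Twisted Leibniz rule: `(τ - μν)(fg) = (τ - μ)f · τg + μ f · (τ - ν)g`. Each summand lowers one
of the two nilpotency exponents, so induction on a bound for their sum applies. -/
theorem mul_mem_maxGenEigenspace (τ : E →ₐ[k] E) {μ ν : k} {f g : E}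
    (hf : f ∈ Module.End.maxGenEigenspace τ.toLinearMap μ)
    (hg : g ∈ Module.End.maxGenEigenspace τ.toLinearMap ν) :
    f * g ∈ Module.End.maxGenEigenspace τ.toLinearMap (μ * ν) := by
  have key : ∀ N a b : ℕ, a + b ≤ N → ∀ f g : E,
      ((τ.toLinearMap - μ • (1 : Module.End k E)) ^ a) f = 0 →
      ((τ.toLinearMap - ν • (1 : Module.End k E)) ^ b) g = 0 →
      ((τ.toLinearMap - (μ * ν) • (1 : Module.End k E)) ^ N) (f * g) = 0 := by
    intro N
    induction N with
    | zero =>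
      intro a b hab f g hf hg
      obtain rfl : a = 0 := by omega
      have : f = 0 := by simpa using hf
      simp [this]
    | succ N ih =>
      intro a b hab f g hf hg
      rcases a with _ | a
      · have : f = 0 := by simpa using hf
        simp [this]
      rcases b with _ | b
      · have : g = 0 := by simpa using hg
        simp [this]
      have hcomm : ∀ (ν : k) (b : ℕ) (g : E),
          ((τ.toLinearMap - ν • (1 : Module.End k E)) ^ b) g = 0 →
          ((τ.toLinearMap - ν • (1 : Module.End k E)) ^ b) (τ g) = 0 := by
        intro ν b g hg
        have hc : Commute ((τ.toLinearMap - ν • (1 : Module.End k E)) ^ b) τ.toLinearMap :=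
          (((Commute.refl _).sub_left ((Commute.one_left _).smul_left ν))).pow_left b
        have := LinearMap.congr_fun hc.eq g
        rw [Module.End.mul_apply, Module.End.mul_apply, hg, map_zero] at this
        exact this
      have hstep : (τ.toLinearMap - (μ * ν) • (1 : Module.End k E)) (f * g) =
          (τ.toLinearMap - μ • (1 : Module.End k E)) f * τ g +
            μ • (f * (τ.toLinearMap - ν • (1 : Module.End k E)) g) := by
        simp only [LinearMap.sub_apply, LinearMap.smul_apply, Module.End.one_apply,
          AlgHom.toLinearMap_apply, map_mul]
        simp only [Algebra.smul_def, map_mul]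
        ring
      rw [pow_succ, Module.End.mul_apply, hstep, map_add, map_smul,
        ih a (b + 1) (by omega) _ _ ?_ (hcomm ν _ _ hg),
        ih (a + 1) b (by omega) _ _ hf ?_, smul_zero, add_zero]
      · rwa [pow_succ, Module.End.mul_apply] at hg
      · rwa [pow_succ, Module.End.mul_apply] at hf
  obtain ⟨a, ha⟩ := (Module.End.mem_maxGenEigenspace _ _ _).1 hf
  obtain ⟨b, hb⟩ := (Module.End.mem_maxGenEigenspace _ _ _).1 hg
  exact (Module.End.mem_maxGenEigenspace _ _ _).2 ⟨a + b, key _ a b le_rfl f g ha hb⟩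

theorem mul_mem_genSpace (τ : E →ₐ[k] E) {d e : ℕ} {f g : E}
    (hf : f ∈ W.genSpace τ.toLinearMap d) (hg : g ∈ W.genSpace τ.toLinearMap e) :
    f * g ∈ W.genSpace τ.toLinearMap (d + e) := by
  have hf' := hf
  rw [genSpace, iSup_subtype'] at hf'
  induction hf' using Submodule.iSup_induction' with
  | zero => simp
  | add x y hx hy ihx ihy =>
    rw [add_mul]
    rw [← iSup_subtype' (p := fun μ => μ ∈ W.weight d)
      (f := fun μ _ => Module.End.maxGenEigenspace τ.toLinearMap μ)] at hx hy
    exact Submodule.add_mem _ (ihx hx) (ihy hy)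
  | mem μ x hx =>
    have hg' := hg
    rw [genSpace, iSup_subtype'] at hg'
    induction hg' using Submodule.iSup_induction' with
    | zero => simp
    | add y z hy hz ihy ihz =>
      rw [mul_add]
      rw [← iSup_subtype' (p := fun μ => μ ∈ W.weight e)
        (f := fun μ _ => Module.End.maxGenEigenspace τ.toLinearMap μ)] at hy hz
      exact Submodule.add_mem _ (ihy hy) (ihz hz)
    | mem ν y hy =>
      exact W.maxGenEigenspace_le_genSpace _ (W.mul_mem μ.2 ν.2)
        (mul_mem_maxGenEigenspace τ hx hy)

theorem one_mem_genSpace (τ : E →ₐ[k] E) : 1 ∈ W.genSpace τ.toLinearMap 0 :=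
  W.maxGenEigenspace_le_genSpace _ W.one_mem
    ((Module.End.mem_maxGenEigenspace _ _ _).2 ⟨1, by simp⟩)

theorem pow_mem_genSpace (τ : E →ₐ[k] E) {f : E} (hf : f ∈ W.genSpace τ.toLinearMap 1) (m : ℕ) :
    f ^ m ∈ W.genSpace τ.toLinearMap m := by
  induction m with
  | zero => simpa using W.one_mem_genSpace τ
  | succ m ih => rw [pow_succ]; exact W.mul_mem_genSpace τ ih hf

theorem prod_mem_genSpace (τ : E →ₐ[k] E) {ι : Type*} (s : Finset ι) {f : ι → E} {d : ι → ℕ}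
    (hf : ∀ i ∈ s, f i ∈ W.genSpace τ.toLinearMap (d i)) :
    ∏ i ∈ s, f i ∈ W.genSpace τ.toLinearMap (∑ i ∈ s, d i) := by
  classical
  induction s using Finset.induction_on with
  | empty => simpa using W.one_mem_genSpace τ
  | insert a s ha ih =>
    rw [Finset.prod_insert ha, Finset.sum_insert ha]
    exact W.mul_mem_genSpace τ (hf a (Finset.mem_insert_self a s))
      (ih fun i hi => hf i (Finset.mem_insert_of_mem hi))

theorem mem_genSpace_of_isHomogeneous {σ : Type*} (τ : MvPolynomial σ k →ₐ[k] MvPolynomial σ k)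
    (hX : ∀ i, MvPolynomial.X i ∈ W.genSpace τ.toLinearMap 1) {d : ℕ} {f : MvPolynomial σ k}
    (hf : f.IsHomogeneous d) : f ∈ W.genSpace τ.toLinearMap d := by
  rw [f.as_sum]
  refine Submodule.sum_mem _ fun e he => ?_
  have hd : e.degree = d := by
    have := hf (MvPolynomial.mem_support_iff.1 he)
    rwa [Finsupp.degree_eq_weight_one]
  rw [MvPolynomial.monomial_eq, ← MvPolynomial.smul_eq_C_mul, ← hd]
  exact Submodule.smul_mem _ _ (W.prod_mem_genSpace τ _ fun i _ => W.pow_mem_genSpace τ (hX i) _)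

end Algebra

end WeightSystem

/-! ### Frobenius weights on logarithmic components -/

namespace CharacterTorus

variable {l : ℕ} [Fact l.Prime] {n : ℕ}

/-- The endomorphism of `Λ ^ n` induced by an endomorphism of `ℤ_l ^ n`. -/
def latticeBaseChange (F : Lattice l n →ₗ[ℤ_[l]] Lattice l n) :
    Module.End (PadicAlgCl l) (Fin n → PadicAlgCl l) :=
  Matrix.toLin' ((LinearMap.toMatrix' F).map (algebraMap ℤ_[l] (PadicAlgCl l)))

theorem charpoly_latticeBaseChange (F : Lattice l n →ₗ[ℤ_[l]] Lattice l n) :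
    (latticeBaseChange F).charpoly = F.charpoly.map (algebraMap ℤ_[l] (PadicAlgCl l)) := by
  rw [latticeBaseChange, Matrix.charpoly_toLin', Matrix.charpoly_map,
    ← LinearMap.charpoly_toMatrix F (Pi.basisFun ℤ_[l] (Fin n))]
  rfl

/-- The linear form with given coefficients. -/
def linearForm : (Fin n → PadicAlgCl l) →ₗ[PadicAlgCl l] MvPolynomial (Fin n) (PadicAlgCl l) :=
  Fintype.linearCombination (PadicAlgCl l) MvPolynomial.X

theorem linearForm_latticeBaseChange (F : Lattice l n →ₗ[ℤ_[l]] Lattice l n)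
    (c : Fin n → PadicAlgCl l) :
    linearForm (latticeBaseChange F c) = polynomialAction F (linearForm c) := by
  simp only [linearForm, Fintype.linearCombination_apply, map_sum, map_smul, polynomialAction,
    MvPolynomial.aeval_X, latticeBaseChange, Matrix.toLin'_apply, Matrix.mulVec, dotProduct,
    Finset.sum_smul, Finset.smul_sum]
  rw [Finset.sum_comm]
  refine Finset.sum_congr rfl fun i _ => Finset.sum_congr rfl fun j _ => ?_
  rw [Matrix.map_apply, LinearMap.toMatrix'_apply, mul_comm, mul_smul, algebraMap_smul]

/-- Over the algebraically closed `Λ`, the space `Λ ^ n` is the sum of the generalized eigenspaces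
of `F`, and passing to linear forms intertwines the two actions. -/
theorem linearForm_mem_genSpace (W : WeightSystem (PadicAlgCl l))
    (F : Lattice l n →ₗ[ℤ_[l]] Lattice l n)
    (hF : ∀ α : PadicAlgCl l, Polynomial.aeval α F.charpoly = 0 → α ∈ W.weight 1)
    (c : Fin n → PadicAlgCl l) :
    linearForm c ∈ W.genSpace (polynomialAction F).toLinearMap 1 := by
  have h : c ∈ ⨆ μ, (latticeBaseChange F).maxGenEigenspace μ := by
    rw [Module.End.iSup_maxGenEigenspace_eq_top]; trivial
  induction h using Submodule.iSup_induction' with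
  | zero => simp
  | add x y _ _ hx hy => rw [map_add]; exact Submodule.add_mem _ hx hy
  | mem μ x hx =>
    by_cases hx0 : x = 0
    · simp [hx0]
    have hμ : (latticeBaseChange F).HasEigenvalue μ := by
      by_contra hcon
      refine hx0 ((Submodule.mem_bot (PadicAlgCl l)).1 ?_)
      rwa [← not_not.1 (mt (Module.End.HasUnifEigenvalue.lt (k := ⊤) zero_lt_one) hcon)]
    have hroot : μ ∈ W.weight 1 := by
      apply hF
      rw [Module.End.hasEigenvalue_iff_isRoot_charpoly, charpoly_latticeBaseChange,
        Polynomial.IsRoot, Polynomial.eval_map] at hμ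
      exact hμ
    refine W.maxGenEigenspace_le_genSpace _ hroot ?_
    obtain ⟨m, hm⟩ := (Module.End.mem_maxGenEigenspace _ _ _).1 hx
    refine (Module.End.mem_maxGenEigenspace _ _ _).2 ⟨m, ?_⟩
    have h3 := WeightSystem.aeval_apply_intertwine (A := latticeBaseChange F)
      (τ := (polynomialAction F).toLinearMap) (c := linearForm)
      (linearForm_latticeBaseChange F) ((Polynomial.X - Polynomial.C μ) ^ m) x
    simp only [map_pow, map_sub, Polynomial.aeval_X, Polynomial.aeval_C,
      Algebra.algebraMap_eq_smul_one] at h3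
    rw [← h3, hm, map_zero]

theorem logComponent_mem_genSpace (W : WeightSystem (PadicAlgCl l))
    (F : Lattice l n →ₗ[ℤ_[l]] Lattice l n)
    (hF : ∀ α : PadicAlgCl l, Polynomial.aeval α F.charpoly = 0 → α ∈ W.weight 1)
    (d : ℕ) (f : R l n) :
    logComponent d f ∈ W.genSpace (polynomialAction F).toLinearMap d := by
  refine W.mem_genSpace_of_isHomogeneous _ (fun i => ?_) (isHomogeneous_logComponent d f)
  have h := linearForm_mem_genSpace W F hF (Pi.single i 1)
  rwa [linearForm, Fintype.linearCombination_apply_single, one_smul] at h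

/-- The weight system on a field of characteristic zero defined by a complex embedding of its
subfield of algebraic numbers and a real number greater than one. -/
def absWeightSystem {k : Type*} [Field k] [CharZero k] (ι : algebraicClosure ℚ k →ₐ[ℚ] ℂ)
    (r : ℝ) (hr : 1 < r) : WeightSystem k where
  weight d := {μ | ∃ x : algebraicClosure ℚ k, (x : k) = μ ∧ ‖ι x‖ = r ^ d}
  one_mem := ⟨1, rfl, by simp⟩
  mul_mem := by
    rintro d e _ _ ⟨x, rfl, hx⟩ ⟨y, rfl, hy⟩
    exact ⟨x * y, rfl, by rw [map_mul, norm_mul, hx, hy, pow_add]⟩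
  disjoint := by
    rintro d e _ ⟨x, rfl, hx⟩ ⟨y, hxy, hy⟩
    rw [Subtype.ext hxy, hx] at hy
    exact pow_right_injective₀ (by linarith) hr.ne' hy

/-- One embedding of the algebraic numbers of `k` into `ℂ` suffices: degree `d` gets absolute value
`r ^ d` with `r = p ^ (w / 2)`, and `w > 0` makes `r > 1`, so the degrees are separated. -/
theorem exists_weightSystem {k : Type*} [Field k] [CharZero k] {p w : ℕ} (hp : 1 < p)
    (hw : 0 < w) : ∃ W : WeightSystem k, ∀ α : k, IsWeilNumber p w α → α ∈ W.weight 1 := by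
  have : Algebra.IsAlgebraic ℚ (algebraicClosure ℚ k) := algebraicClosure.isAlgebraic ℚ k
  let ι : algebraicClosure ℚ k →ₐ[ℚ] ℂ := IsAlgClosed.lift
  have hr : (1 : ℝ) < (p : ℝ) ^ ((w : ℝ) / 2) :=
    Real.one_lt_rpow (by exact_mod_cast hp) (by positivity)
  refine ⟨absWeightSystem ι _ hr, fun α hα => ?_⟩
  obtain ⟨halg, -, habs⟩ := hα
  refine ⟨⟨α, mem_algebraicClosure_iff.2 halg⟩, rfl, ?_⟩
  rw [pow_one]
  apply habs
  set x : algebraicClosure ℚ k := ⟨α, mem_algebraicClosure_iff.2 halg⟩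
  have h : minpoly ℚ α = minpoly ℚ x :=
    minpoly.algHom_eq (algebraicClosure ℚ k).val Subtype.val_injective x
  rw [h, Polynomial.aeval_algHom_apply, minpoly.aeval, map_zero]

theorem exists_isolate_logComponent (W : WeightSystem (PadicAlgCl l))
    (F : Lattice l n →ₗ[ℤ_[l]] Lattice l n)
    (hF : ∀ α : PadicAlgCl l, Polynomial.aeval α F.charpoly = 0 → α ∈ W.weight 1)
    {I : Ideal (R l n)} (hI : ∀ f ∈ I, action F f ∈ I) {f : R l n} (hf : f ∈ I) (d : ℕ) :
    ∃ g ∈ I, logComponent d g = logComponent d f ∧ ∀ e < d, logComponent e g = 0 :=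
  W.exists_isolate_component (A := (action F).toLinearMap)
    (τ := (polynomialAction F).toLinearMap) (c := logComponent)
    (fun e x => logComponent_action F e x) (fun e x => logComponent_mem_genSpace W F hF e x)
    (I := I.restrictScalars (PadicAlgCl l)) hI hf d

end CharacterTorus

end

/-! ### Leading forms and the tangent cone -/

noncomputable section

theorem MvPowerSeries.mem_span_X_of_constantCoeff_eq_zero {σ A : Type*} [Finite σ] [CommRing A]
    {f : MvPowerSeries σ A} (hf : MvPowerSeries.constantCoeff f = 0) :
    f ∈ Ideal.span (Set.range (MvPowerSeries.X : σ → MvPowerSeries σ A)) := by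
  classical
  have := Fintype.ofFinite σ
  -- Induction on a set `s` of variables such that every monomial of `f` involves one of them;
  -- removing `a` from `s` splits off the part of `f` divisible by `X a`.
  suffices H : ∀ (s : Finset σ) (f : MvPowerSeries σ A),
      (∀ e : σ →₀ ℕ, (∀ j ∈ s, e j = 0) → MvPowerSeries.coeff e f = 0) →
      f ∈ Ideal.span (Set.range (MvPowerSeries.X : σ → MvPowerSeries σ A)) by
    refine H Finset.univ f fun e he => ?_
    have : e = 0 := Finsupp.ext fun j => he j (Finset.mem_univ j)
    rw [this, MvPowerSeries.coeff_zero_eq_constantCoeff_apply, hf]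
  intro s
  induction s using Finset.induction_on with
  | empty =>
    intro f hf
    have : f = 0 := MvPowerSeries.ext fun e => by simpa using hf e (by simp)
    rw [this]
    exact Ideal.zero_mem _
  | insert a s ha ih =>
    intro f hf
    let f₁ : MvPowerSeries σ A := fun e => if e a = 0 then MvPowerSeries.coeff e f else 0
    have hf₁ : ∀ e, MvPowerSeries.coeff e f₁ =
      if e a = 0 then MvPowerSeries.coeff e f else 0 := fun e => rfl
    have h1 : f₁ ∈ Ideal.span (Set.range (MvPowerSeries.X : σ → MvPowerSeries σ A)) := by
      refine ih f₁ fun e he => ?_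
      rw [hf₁]
      split_ifs with h
      · exact hf e (Finset.forall_mem_insert _ _ _ |>.2 ⟨h, he⟩)
      · rfl
    have h2 : (MvPowerSeries.X a : MvPowerSeries σ A) ∣ f - f₁ := by
      rw [MvPowerSeries.X_dvd_iff]
      intro e he
      rw [map_sub, hf₁, if_pos he, sub_self]
    rw [← sub_add_cancel f f₁]
    exact Ideal.add_mem _ (Ideal.mem_of_dvd _ h2 (Ideal.subset_span ⟨a, rfl⟩)) h1

/-- An expansion of the elements of an augmented algebra in homogeneous polynomials, such that the
generators of the augmentation ideal have the variables as their leading forms. The exponent of the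
power series variable records the degree. -/
structure HomogeneousExpansion (K σ S : Type*) [Field K] [CommRing S] [Algebra K S] where
  /-- The expansion. -/
  expansion : S →ₐ[K] PowerSeries (MvPolynomial σ K)
  /-- The generators of the augmentation ideal. -/
  coord : σ → S
  isHomogeneous_coeff : ∀ d f, (PowerSeries.coeff d (expansion f)).IsHomogeneous d
  coeff_one_coord : ∀ i, PowerSeries.coeff 1 (expansion (coord i)) = MvPolynomial.X i
  coeff_zero_coord : ∀ i, PowerSeries.coeff 0 (expansion (coord i)) = 0
  exists_sub_algebraMap_mem : ∀ f, ∃ c : K, f - algebraMap K S c ∈ Ideal.span (Set.range coord)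

namespace HomogeneousExpansion

variable {K σ S : Type*} [Field K] [CommRing S] [Algebra K S] {E : HomogeneousExpansion K σ S}

variable (E) in
/-- The homogeneous component of degree `d`. -/
def component (d : ℕ) : S →ₗ[K] MvPolynomial σ K :=
  (PowerSeries.coeff d).restrictScalars K ∘ₗ E.expansion.toLinearMap

theorem component_apply (d : ℕ) (f : S) :
    E.component d f = PowerSeries.coeff d (E.expansion f) := rfl

variable (E) in
/-- The augmentation ideal. -/
def maxIdeal : Ideal S := Ideal.span (Set.range E.coord)

variable (E) in
/-- The expansion of `f` in homogeneous polynomials starts with `h` in degree `d`. -/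
structure HasLeadingForm (d : ℕ) (f : S) (h : MvPolynomial σ K) : Prop where
  eq_zero : ∀ e < d, E.component e f = 0
  eq : E.component d f = h

namespace HasLeadingForm

theorem X_pow_dvd {d : ℕ} {f : S} {h : MvPolynomial σ K}
    (H : E.HasLeadingForm d f h) : PowerSeries.X ^ d ∣ E.expansion f :=
  PowerSeries.X_pow_dvd_iff.2 H.eq_zero

theorem of_expansion_eq {d : ℕ} {f : S}
    {p : PowerSeries (MvPolynomial σ K)}
    (h : E.expansion f = PowerSeries.X ^ d * p) :
    E.HasLeadingForm d f (PowerSeries.constantCoeff p) where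
  eq_zero := PowerSeries.X_pow_dvd_iff.1 ⟨p, h⟩
  eq := by
    rw [component_apply, h, PowerSeries.coeff_X_pow_mul', if_pos le_rfl, Nat.sub_self,
      PowerSeries.coeff_zero_eq_constantCoeff_apply]

theorem mul {d e : ℕ} {f g : S} {h k : MvPolynomial σ K}
    (hf : E.HasLeadingForm d f h) (hg : E.HasLeadingForm e g k) :
    E.HasLeadingForm (d + e) (f * g) (h * k) := by
  obtain ⟨p, hp⟩ := hf.X_pow_dvd
  obtain ⟨q, hq⟩ := hg.X_pow_dvd
  have h1 := of_expansion_eq (d := d + e) (f := f * g) (p := p * q) (by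
    rw [map_mul, hp, hq]; ring)
  rwa [map_mul, ← (of_expansion_eq hp).eq, ← (of_expansion_eq hq).eq, hf.eq, hg.eq] at h1

theorem add {d : ℕ} {f g : S} {h k : MvPolynomial σ K}
    (hf : E.HasLeadingForm d f h) (hg : E.HasLeadingForm d g k) :
    E.HasLeadingForm d (f + g) (h + k) :=
  ⟨fun e he => by rw [map_add, hf.eq_zero e he, hg.eq_zero e he, add_zero],
    by rw [map_add, hf.eq, hg.eq]⟩

theorem smul {d : ℕ} {f : S} {h : MvPolynomial σ K} (c : K)
    (hf : E.HasLeadingForm d f h) : E.HasLeadingForm d (c • f) (c • h) :=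
  ⟨fun e he => by rw [map_smul, hf.eq_zero e he, smul_zero], by rw [map_smul, hf.eq]⟩

theorem zero (d : ℕ) : E.HasLeadingForm d (0 : S) 0 :=
  ⟨fun _ _ => map_zero _, map_zero _⟩

theorem one : E.HasLeadingForm 0 (1 : S) 1 :=
  ⟨fun _ he => by omega, by rw [component_apply, map_one]; simp⟩

theorem coord (i : σ) : E.HasLeadingForm 1 (E.coord i) (MvPolynomial.X i) :=
  ⟨fun e he => by obtain rfl : e = 0 := (by omega); exact E.coeff_zero_coord i,
    E.coeff_one_coord i⟩

theorem pow {d : ℕ} {f : S} {h : MvPolynomial σ K}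
    (hf : E.HasLeadingForm d f h) (m : ℕ) : E.HasLeadingForm (m * d) (f ^ m) (h ^ m) := by
  induction m with
  | zero => simpa using one
  | succ m ih => rw [pow_succ, pow_succ, add_mul, one_mul]; exact ih.mul hf

theorem prod {ι : Type*} (s : Finset ι) {d : ι → ℕ} {f : ι → S}
    {h : ι → MvPolynomial σ K} (H : ∀ i ∈ s, E.HasLeadingForm (d i) (f i) (h i)) :
    E.HasLeadingForm (∑ i ∈ s, d i) (∏ i ∈ s, f i) (∏ i ∈ s, h i) := by
  classical
  induction s using Finset.induction_on with
  | empty => simpa using one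
  | insert a s ha ih =>
    rw [Finset.prod_insert ha, Finset.prod_insert ha, Finset.sum_insert ha]
    exact (H a (Finset.mem_insert_self a s)).mul
      (ih fun i hi => H i (Finset.mem_insert_of_mem hi))

theorem sum {ι : Type*} (s : Finset ι) {d : ℕ} {f : ι → S}
    {h : ι → MvPolynomial σ K} (H : ∀ i ∈ s, E.HasLeadingForm d (f i) (h i)) :
    E.HasLeadingForm d (∑ i ∈ s, f i) (∑ i ∈ s, h i) := by
  classical
  induction s using Finset.induction_on with
  | empty => simpa using zero d
  | insert a s ha ih =>
    rw [Finset.sum_insert ha, Finset.sum_insert ha]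
    exact (H a (Finset.mem_insert_self a s)).add
      (ih fun i hi => H i (Finset.mem_insert_of_mem hi))

/-- A homogeneous polynomial is the leading form of its value at the coordinates. -/
theorem aeval_coord {d : ℕ} {h : MvPolynomial σ K} (hh : h.IsHomogeneous d) :
    E.HasLeadingForm d (MvPolynomial.aeval E.coord h) h := by
  have h1 : E.HasLeadingForm d (∑ e ∈ h.support, MvPolynomial.aeval E.coord
      (MvPolynomial.monomial e (h.coeff e)))
      (∑ e ∈ h.support, MvPolynomial.monomial e (h.coeff e)) := by
    refine sum _ fun e he => ?_
    have hd : e.degree = d := by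
      have := hh (MvPolynomial.mem_support_iff.1 he)
      rwa [Finsupp.degree_eq_weight_one]
    rw [MvPolynomial.monomial_eq, ← MvPolynomial.smul_eq_C_mul, map_smul, ← hd, Finsupp.prod,
      map_prod]
    refine smul _ (prod _ fun i _ => ?_)
    rw [map_pow, MvPolynomial.aeval_X]
    simpa using (coord (E := E) i).pow (e i)
  rwa [← map_sum, ← h.as_sum] at h1

end HasLeadingForm

theorem X_dvd_expansion_of_mem_maxIdeal {f : S} (hf : f ∈ E.maxIdeal) :
    PowerSeries.X ∣ E.expansion f := by
  rw [← Ideal.mem_span_singleton, ← Ideal.mem_comap]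
  refine (Ideal.span_le.2 ?_ : E.maxIdeal ≤ _) hf
  rintro _ ⟨i, rfl⟩
  rw [SetLike.mem_coe, Ideal.mem_comap, Ideal.mem_span_singleton]
  simpa [coord] using (HasLeadingForm.coord (E := E) i).X_pow_dvd

theorem component_eq_zero_of_mem_maxIdeal_pow {k e : ℕ} (he : e < k) {f : S}
    (hf : f ∈ E.maxIdeal ^ k) : E.component e f = 0 := by
  have h1 : E.maxIdeal ≤ Ideal.comap E.expansion (Ideal.span {PowerSeries.X}) := fun g hg =>
    Ideal.mem_span_singleton.2 (X_dvd_expansion_of_mem_maxIdeal hg)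
  have h2 := Ideal.le_comap_pow E.expansion k (Ideal.pow_right_mono h1 k hf)
  rw [Ideal.mem_comap, Ideal.span_singleton_pow, Ideal.mem_span_singleton] at h2
  exact PowerSeries.X_pow_dvd_iff.1 h2 e he

theorem exists_homogeneous_sub_mem_maxIdeal {f : S} (hf : f ∈ E.maxIdeal) :
    ∃ h : MvPolynomial σ K, h.IsHomogeneous 1 ∧
      f - MvPolynomial.aeval E.coord h ∈ E.maxIdeal ^ 2 := by
  induction hf using Submodule.span_induction with
  | mem x hx =>
    obtain ⟨i, rfl⟩ := hx
    refine ⟨MvPolynomial.X i, MvPolynomial.isHomogeneous_X _ i, ?_⟩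
    rw [MvPolynomial.aeval_X, coord, sub_self]
    exact Ideal.zero_mem _
  | zero => exact ⟨0, MvPolynomial.isHomogeneous_zero _ _ _, by simp⟩
  | add x y _ _ hx hy =>
    obtain ⟨h, hh, hx⟩ := hx
    obtain ⟨k, hk, hy⟩ := hy
    exact ⟨h + k, hh.add hk, by rw [map_add, add_sub_add_comm]; exact Ideal.add_mem _ hx hy⟩
  | smul r x hxm hx =>
    obtain ⟨h, hh, hx⟩ := hx
    obtain ⟨c, hc⟩ := E.exists_sub_algebraMap_mem r
    refine ⟨c • h, (MvPolynomial.homogeneousSubmodule _ _ 1).smul_mem c hh, ?_⟩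
    have : r • x - MvPolynomial.aeval E.coord (c • h) = (r - algebraMap _ _ c) * x +
        algebraMap _ _ c * (x - MvPolynomial.aeval E.coord h) := by
      rw [map_smul, smul_eq_mul]
      rw [Algebra.smul_def]; ring
    rw [this]
    refine Ideal.add_mem _ ?_ (Ideal.mul_mem_left _ _ hx)
    rw [pow_two]
    exact Ideal.mul_mem_mul hc hxm

theorem aeval_coord_mem_maxIdeal_pow {k : ℕ} {h : MvPolynomial σ K}
    (hh : h.IsHomogeneous k) : MvPolynomial.aeval E.coord h ∈ E.maxIdeal ^ k := by
  rw [h.as_sum, map_sum]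
  refine Ideal.sum_mem _ fun e he => ?_
  have hd : e.degree = k := by
    have := hh (MvPolynomial.mem_support_iff.1 he)
    rwa [Finsupp.degree_eq_weight_one]
  rw [MvPolynomial.aeval_monomial, ← hd, Finsupp.degree_apply, ← Finset.prod_pow_eq_pow_sum]
  exact Ideal.mul_mem_left _ _ (Ideal.prod_mem_prod fun i _ =>
    Ideal.pow_mem_pow (Ideal.subset_span (Set.mem_range_self i)) _)

theorem exists_homogeneous_sub_mem_maxIdeal_pow (k : ℕ) {f : S} (hf : f ∈ E.maxIdeal ^ k) :
    ∃ h : MvPolynomial σ K, h.IsHomogeneous k ∧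
      f - MvPolynomial.aeval E.coord h ∈ E.maxIdeal ^ (k + 1) := by
  induction k generalizing f with
  | zero =>
    obtain ⟨c, hc⟩ := E.exists_sub_algebraMap_mem f
    exact ⟨MvPolynomial.C c, MvPolynomial.isHomogeneous_C _ _, by
      rwa [MvPolynomial.aeval_C, zero_add, pow_one]⟩
  | succ k ih =>
    rw [pow_succ] at hf
    induction hf using Submodule.mul_induction_on' with
    | mem_mul_mem x hx y hy =>
      obtain ⟨h, hh, hx'⟩ := ih hx
      obtain ⟨g, hg, hy'⟩ := exists_homogeneous_sub_mem_maxIdeal hy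
      refine ⟨h * g, hh.mul hg, ?_⟩
      have : x * y - MvPolynomial.aeval E.coord (h * g) =
          (x - MvPolynomial.aeval E.coord h) * y +
            MvPolynomial.aeval E.coord h * (y - MvPolynomial.aeval E.coord g) := by
        rw [map_mul]; ring
      rw [this]
      refine Ideal.add_mem _ ?_ ?_
      · rw [pow_succ]; exact Ideal.mul_mem_mul hx' hy
      · rw [show k + 1 + 1 = k + 2 from rfl, pow_add]
        exact Ideal.mul_mem_mul (aeval_coord_mem_maxIdeal_pow hh) hy'
    | add x _ y _ hx hy =>
      obtain ⟨h, hh, hx⟩ := hx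
      obtain ⟨k, hk, hy⟩ := hy
      exact ⟨h + k, hh.add hk, by rw [map_add, add_sub_add_comm]; exact Ideal.add_mem _ hx hy⟩

/-- The order of the expansion is the order for powers of the augmentation ideal. Modulo the next
power, an element of the `k`-th power is a form of degree `k` in the coordinates, and that form is
its `k`-th component. -/
theorem mem_maxIdeal_pow_of_component_eq_zero {k : ℕ} {f : S}
    (hf : ∀ e < k, E.component e f = 0) : f ∈ E.maxIdeal ^ k := by
  induction k with
  | zero => simp
  | succ k ih =>
    obtain ⟨h, hh, hfh⟩ := exists_homogeneous_sub_mem_maxIdeal_pow k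
      (ih fun e he => hf e (he.trans (Nat.lt_succ_self k)))
    have h1 := component_eq_zero_of_mem_maxIdeal_pow (Nat.lt_succ_self k) hfh
    rw [map_sub, hf k (Nat.lt_succ_self k), (HasLeadingForm.aeval_coord hh).eq, zero_sub,
      neg_eq_zero] at h1
    simpa [h1] using hfh

variable (E) in
/-- The leading forms of degree `d` of the elements of an ideal. -/
def leadingForms (I : Ideal S) (d : ℕ) :
    Submodule K (MvPolynomial σ K) where
  carrier := {h | ∃ g ∈ I, E.HasLeadingForm d g h}
  zero_mem' := ⟨0, I.zero_mem, HasLeadingForm.zero d⟩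
  add_mem' := by
    rintro h k ⟨f, hf, hfh⟩ ⟨g, hg, hgk⟩
    exact ⟨f + g, I.add_mem hf hg, hfh.add hgk⟩
  smul_mem' := by
    rintro c h ⟨f, hf, hfh⟩
    exact ⟨c • f, Submodule.smul_of_tower_mem I c hf, hfh.smul c⟩

theorem isHomogeneous_of_mem_leadingForms {I : Ideal S} {d : ℕ}
    {h : MvPolynomial σ K} (hh : h ∈ E.leadingForms I d) : h.IsHomogeneous d := by
  obtain ⟨g, -, hg⟩ := hh
  rw [← hg.eq]
  exact E.isHomogeneous_coeff d g

variable (E) in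
/-- The ideal of the tangent cone at the trivial character: the span of all leading forms. -/
def tangentConeIdeal (I : Ideal S) : Ideal (MvPolynomial σ K) where
  __ := (⨆ d, E.leadingForms I d).toAddSubmonoid
  smul_mem' p h hh := by
    change p * h ∈ ⨆ d, E.leadingForms I d
    have hh : h ∈ ⨆ d, E.leadingForms I d := hh
    induction p using MvPolynomial.induction_on with
    | C c => rw [← MvPolynomial.smul_eq_C_mul]; exact Submodule.smul_mem _ c hh
    | add p q hp hq => rw [add_mul]; exact Submodule.add_mem _ hp hq
    | mul_X p i hp =>
      rw [mul_right_comm]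
      generalize p * h = h at hp
      induction hp using Submodule.iSup_induction' with
      | zero => rw [zero_mul]; exact Submodule.zero_mem _
      | add x y _ _ hx hy => rw [add_mul]; exact Submodule.add_mem _ hx hy
      | mem d x hx =>
        obtain ⟨g, hg, hgx⟩ := hx
        exact Submodule.mem_iSup_of_mem (d + 1)
          ⟨g * E.coord i, I.mul_mem_right _ hg, hgx.mul (HasLeadingForm.coord i)⟩

theorem mem_tangentConeIdeal_iff {I : Ideal S} {h : MvPolynomial σ K} :
    h ∈ E.tangentConeIdeal I ↔ h ∈ ⨆ d, E.leadingForms I d := Iff.rfl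

theorem mem_leadingForms_of_mem_tangentConeIdeal {I : Ideal S} {d : ℕ}
    {h : MvPolynomial σ K} (hh : h ∈ E.tangentConeIdeal I)
    (hd : h.IsHomogeneous d) : h ∈ E.leadingForms I d := by
  rw [mem_tangentConeIdeal_iff] at hh
  rw [← MvPolynomial.homogeneousComponent_eq_self hd]
  clear hd
  induction hh using Submodule.iSup_induction' with
  | zero => rw [map_zero]; exact Submodule.zero_mem _
  | add x y _ _ hx hy => rw [map_add]; exact Submodule.add_mem _ hx hy
  | mem e x hx =>
    rw [MvPolynomial.homogeneousComponent_of_mem (isHomogeneous_of_mem_leadingForms hx)]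
    split_ifs with h
    · rw [h]; exact hx
    · exact Submodule.zero_mem _

theorem maxIdeal_fg [Finite σ] : E.maxIdeal.FG :=
  Submodule.fg_span (Set.finite_range _)

/-- Some power `M` of the irrelevant ideal lies in the tangent cone ideal, so every form of degree
`M` is the leading form of an element of `I`. This puts `m ^ M` inside `I + m ^ (M + 1)`, ready for
Nakayama. -/
theorem maxIdeal_le_of_X_mem_radical [Finite σ] {I : Ideal S} [hI : I.IsPrime]
    (hIm : I ≤ E.maxIdeal) (hm : E.maxIdeal ≠ ⊤)
    (hX : ∀ i, MvPolynomial.X i ∈ (E.tangentConeIdeal I).radical) : E.maxIdeal ≤ I := by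
  obtain ⟨M, hM⟩ := Ideal.exists_pow_le_of_le_radical_of_fg
    (I := Ideal.span (Set.range (MvPolynomial.X : σ → MvPolynomial σ K)))
    (Ideal.span_le.2 (Set.range_subset_iff.2 hX)) (Submodule.fg_span (Set.finite_range _))
  have hle : E.maxIdeal ^ M ≤ I ⊔ E.maxIdeal • E.maxIdeal ^ M := by
    intro f hf
    obtain ⟨h, hh, hfh⟩ := exists_homogeneous_sub_mem_maxIdeal_pow M hf
    have hJ : h ∈ E.tangentConeIdeal I := by
      apply hM
      rw [h.as_sum]
      refine Ideal.sum_mem _ fun e he => ?_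
      have hd : e.degree = M := by
        have := hh (MvPolynomial.mem_support_iff.1 he)
        rwa [Finsupp.degree_eq_weight_one]
      rw [MvPolynomial.monomial_eq, ← hd, Finsupp.degree_apply, ← Finset.prod_pow_eq_pow_sum]
      exact Ideal.mul_mem_left _ _ (Ideal.prod_mem_prod fun i _ =>
        Ideal.pow_mem_pow (Ideal.subset_span (Set.mem_range_self i)) _)
    obtain ⟨g, hg, hgh⟩ := mem_leadingForms_of_mem_tangentConeIdeal hJ hh
    rw [smul_eq_mul, ← pow_succ']
    refine Submodule.mem_sup.2 ⟨g, hg, f - g, ?_, by ring⟩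
    -- Both terms have the same leading form `h` in degree `M`.
    have h1 : MvPolynomial.aeval E.coord h - g ∈ E.maxIdeal ^ (M + 1) := by
      refine mem_maxIdeal_pow_of_component_eq_zero fun e he => ?_
      have h2 := HasLeadingForm.aeval_coord (E := E) hh
      rcases Nat.lt_succ_iff_lt_or_eq.1 he with he | rfl
      · rw [map_sub, h2.eq_zero e he, hgh.eq_zero e he, sub_zero]
      · rw [map_sub, h2.eq, hgh.eq, sub_self]
    have := Ideal.add_mem _ hfh h1
    rwa [sub_add_sub_cancel] at this
  -- Nakayama without a local ring: `r ≡ 1` modulo `m` carries `m ^ M` into `I`. Since `I ≤ m ≠ ⊤`,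
  -- `r` is not in `I`, and primality removes it.
  obtain ⟨r, hr, hrI⟩ := Submodule.exists_sub_one_mem_and_smul_le_of_fg_of_le_sup
    (Ideal.FG.pow (n := M) (maxIdeal_fg (E := E))) le_rfl hle
  have hrn : r ∉ I := fun hrI' => hm ((Ideal.eq_top_iff_one _).2 (by
    have := Ideal.sub_mem _ (hIm hrI') hr
    rwa [sub_sub_cancel] at this))
  refine Ideal.IsPrime.le_of_pow_le (n := M) fun x hx => ?_
  exact (hI.mem_or_mem (hrI (Submodule.smul_mem_pointwise_smul x r _ hx))).resolve_left hrn

/-- If the cone has no nonzero point, all variables vanish on it, so the Nullstellensatz puts them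
in the radical of its ideal. -/
theorem exists_tangent_vector_or_maxIdeal_le [Finite σ] [IsAlgClosed K] {I : Ideal S} [I.IsPrime]
    (hIm : I ≤ E.maxIdeal) (hm : E.maxIdeal ≠ ⊤) :
    E.maxIdeal ≤ I ∨ ∃ a : σ → K, a ≠ 0 ∧
      ∀ d, ∀ h ∈ E.leadingForms I d, MvPolynomial.aeval a h = 0 := by
  by_contra! hcon
  refine hcon.1 (maxIdeal_le_of_X_mem_radical hIm hm fun i => ?_)
  rw [← MvPolynomial.vanishingIdeal_zeroLocus_eq_radical (K := K)]
  intro a ha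
  by_cases h0 : a = 0
  · simp [h0]
  obtain ⟨d, h, hh, hne⟩ := hcon.2 a h0
  exact absurd (ha h (mem_tangentConeIdeal_iff.2 (Submodule.mem_iSup_of_mem d hh))) hne

end HomogeneousExpansion

/-! ### The tangent cone for `R_n` -/

namespace CharacterTorus

variable {l : ℕ} [Fact l.Prime] {n : ℕ}

/-- The coordinate `t_i` as an element of `R_n`. -/
def coord (i : Fin n) : R l n := (1 : PadicAlgCl l) ⊗ₜ[ℤ_[l]] MvPowerSeries.X i

theorem exists_sub_algebraMap_mem_maxIdeal (f : R l n) :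
    ∃ c : PadicAlgCl l, f - algebraMap _ _ c ∈ maxIdeal l n := by
  induction f using TensorProduct.induction_on with
  | zero => exact ⟨0, by simp⟩
  | add f g hf hg =>
    obtain ⟨c, hc⟩ := hf
    obtain ⟨d, hd⟩ := hg
    exact ⟨c + d, by rw [map_add, add_sub_add_comm]; exact Ideal.add_mem _ hc hd⟩
  | tmul c f =>
    refine ⟨c * algebraMap ℤ_[l] _ (MvPowerSeries.constantCoeff f), ?_⟩
    let r := MvPowerSeries.constantCoeff f
    have h1 : f - algebraMap ℤ_[l] _ r ∈
        Ideal.span (Set.range (MvPowerSeries.X : Fin n → MvPowerSeries (Fin n) ℤ_[l])) := by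
      apply MvPowerSeries.mem_span_X_of_constantCoeff_eq_zero
      rw [map_sub, MvPowerSeries.algebraMap_apply]
      simp [r]
    have h2 := Ideal.mem_map_of_mem (Algebra.TensorProduct.includeRight :
      MvPowerSeries (Fin n) ℤ_[l] →ₐ[ℤ_[l]] R l n) h1
    rw [Ideal.map_span, ← Set.range_comp] at h2
    have h3 : c ⊗ₜ[ℤ_[l]] f - algebraMap (PadicAlgCl l) (R l n) (c * algebraMap ℤ_[l] _ r) =
        c • (Algebra.TensorProduct.includeRight :
          MvPowerSeries (Fin n) ℤ_[l] →ₐ[ℤ_[l]] R l n) (f - algebraMap ℤ_[l] _ r) := by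
      have h4 : (1 : PadicAlgCl l) ⊗ₜ[ℤ_[l]] algebraMap ℤ_[l] (MvPowerSeries (Fin n) ℤ_[l]) r =
          algebraMap (PadicAlgCl l) (R l n) (algebraMap ℤ_[l] _ r) := by
        rw [← IsScalarTower.algebraMap_apply]
        exact (Algebra.TensorProduct.includeRight :
          MvPowerSeries (Fin n) ℤ_[l] →ₐ[ℤ_[l]] R l n).commutes r
      rw [Algebra.TensorProduct.includeRight_apply, TensorProduct.tmul_sub, smul_sub,
        TensorProduct.smul_tmul', smul_eq_mul, mul_one, h4, map_mul, Algebra.smul_def]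
    rw [h3]
    exact Submodule.smul_of_tower_mem _ c h2

variable (l n) in
/-- The expansion in logarithmic coordinates at the trivial character. -/
def logHomogeneousExpansion : HomogeneousExpansion (PadicAlgCl l) (Fin n) (R l n) where
  expansion := logExpansion
  coord := coord
  isHomogeneous_coeff := isHomogeneous_logComponent
  coeff_one_coord i := by
    rw [coord, logExpansion, expLift_tmul, one_smul, expHom_X, coeff_one_expSubOne]
  coeff_zero_coord i := by
    rw [coord, logExpansion, expLift_tmul, one_smul, expHom_X,
      PowerSeries.coeff_zero_eq_constantCoeff_apply, constantCoeff_expSubOne]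
  exists_sub_algebraMap_mem := exists_sub_algebraMap_mem_maxIdeal

theorem exists_tangent_vector_or_maxIdeal_le {I : Ideal (R l n)} (hI : I.IsPrime)
    (hIm : I ≤ maxIdeal l n) (hm : maxIdeal l n ≠ ⊤) :
    maxIdeal l n ≤ I ∨ ∃ a : Fin n → PadicAlgCl l, a ≠ 0 ∧
      ∀ d, ∀ f ∈ I, (∀ e < d, logComponent e f = 0) →
        MvPolynomial.aeval a (logComponent d f) = 0 := by
  have := hI
  refine (HomogeneousExpansion.exists_tangent_vector_or_maxIdeal_le
    (E := logHomogeneousExpansion l n) (I := I) hIm hm).imp id ?_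
  rintro ⟨a, ha, H⟩
  exact ⟨a, ha, fun d f hf h => H d _ ⟨f, hf, h, rfl⟩⟩

end CharacterTorus

end

/-! ### Convergent exponentials, points and characters -/

noncomputable section

namespace CharacterTorus

variable {l : ℕ} [Fact l.Prime] {n : ℕ}

theorem norm_algebraMap_padicInt_le_one (r : ℤ_[l]) : ‖algebraMap ℤ_[l] (PadicAlgCl l) r‖ ≤ 1 := by
  rw [IsScalarTower.algebraMap_apply ℤ_[l] ℚ_[l], norm_algebraMap']
  exact r.2

theorem norm_inv_factorial_le {d : ℕ} (hd : d ≠ 0) :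
    ‖algebraMap ℚ (PadicAlgCl l) (1 / d.factorial)‖ ≤ (l : ℝ) ^ (d - 1) := by
  have hl : (1 : ℝ) ≤ l := by exact_mod_cast (Fact.out : l.Prime).one_lt.le
  have h0 : (d.factorial : ℚ_[l]) ≠ 0 := by exact_mod_cast d.factorial_ne_zero
  have h1 : algebraMap ℚ (PadicAlgCl l) (1 / d.factorial) =
      algebraMap ℚ_[l] (PadicAlgCl l) (d.factorial : ℚ_[l])⁻¹ := by simp
  rw [h1, norm_algebraMap', norm_inv, Padic.norm_eq_zpow_neg_valuation h0,
    Padic.valuation_natCast, zpow_neg, inv_inv, zpow_natCast]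
  exact pow_le_pow_right₀ hl (Nat.le_sub_one_of_lt (padicValNat_factorial_lt_of_ne_zero l hd))

variable (l) in
/-- The inverse of the prime `l`, as a real number. -/
def invPrime : ℝ := (l : ℝ)⁻¹

theorem invPrime_pos : 0 < invPrime l :=
  inv_pos.2 (by exact_mod_cast (Fact.out : l.Prime).pos)

theorem invPrime_lt_one : invPrime l < 1 :=
  inv_lt_one_of_one_lt₀ (by exact_mod_cast (Fact.out : l.Prime).one_lt)

/-- The radius `l ^ (-2)` is not sharp but works for every `l`: one factor `l⁻¹` per degree absorbs
the factorial, the other leaves geometric decay. The factor `‖z‖` is kept for the comparison of `exp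
z` with `1 + z`. -/
theorem norm_coeff_rescale_exp_le {z : PadicAlgCl l} (hz : ‖z‖ ≤ invPrime l ^ 2) (d : ℕ) :
    ‖PowerSeries.coeff (d + 1) (PowerSeries.rescale z (PowerSeries.exp (PadicAlgCl l)))‖ ≤
      ‖z‖ * invPrime l ^ d := by
  have hl : (l : ℝ) ≠ 0 := by exact_mod_cast (Fact.out : l.Prime).ne_zero
  rw [PowerSeries.coeff_rescale, PowerSeries.coeff_exp, norm_mul, norm_pow, pow_succ', mul_assoc]
  refine mul_le_mul_of_nonneg_left ?_ (norm_nonneg z)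
  calc ‖z‖ ^ d * ‖algebraMap ℚ (PadicAlgCl l) (1 / (d + 1).factorial)‖
      ≤ (invPrime l ^ 2) ^ d * (l : ℝ) ^ d := by
        have := norm_inv_factorial_le (l := l) d.succ_ne_zero
        have h0 := invPrime_pos (l := l)
        gcongr
        exact this
    _ = invPrime l ^ d := by
        rw [← mul_pow, invPrime, pow_two, mul_assoc, inv_mul_cancel₀ hl, mul_one]

theorem norm_coeff_expSubOne_le {z : PadicAlgCl l} (hz : ‖z‖ ≤ invPrime l ^ 2) (d : ℕ) :
    ‖PowerSeries.coeff d (expSubOne z)‖ ≤ invPrime l ^ d := by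
  have h0 := invPrime_pos (l := l)
  rcases d with _ | d
  · rw [PowerSeries.coeff_zero_eq_constantCoeff_apply, constantCoeff_expSubOne]; simp
  · rw [expSubOne, map_sub, PowerSeries.coeff_one, if_neg d.succ_ne_zero, sub_zero]
    refine (norm_coeff_rescale_exp_le hz d).trans ?_
    rw [pow_succ']
    gcongr
    refine hz.trans ?_
    rw [pow_two]
    exact mul_le_of_le_one_left h0.le invPrime_lt_one.le

variable (l) in
/-- Power series whose coefficients decay geometrically. -/
def decayingSeries : Submonoid (PowerSeries (PadicAlgCl l)) where
  carrier := {p | ∀ d, ‖PowerSeries.coeff d p‖ ≤ invPrime l ^ d}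
  one_mem' d := by
    have h0 := invPrime_pos (l := l)
    rw [PowerSeries.coeff_one]
    split_ifs with h
    · simp [h]
    · rw [norm_zero]; positivity
  mul_mem' {p q} hp hq d := by
    have h0 := invPrime_pos (l := l)
    rw [PowerSeries.coeff_mul]
    refine IsUltrametricDist.norm_sum_le_of_forall_le_of_nonneg (by positivity) fun x hx => ?_
    rw [← Finset.HasAntidiagonal.mem_antidiagonal.1 hx, norm_mul, pow_add]
    exact mul_le_mul (hp _) (hq _) (norm_nonneg _) (by positivity)

theorem norm_coeff_expHom_le {a : Fin n → PadicAlgCl l} (ha : ∀ j, ‖a j‖ ≤ invPrime l ^ 2)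
    (f : MvPowerSeries (Fin n) ℤ_[l]) (d : ℕ) :
    ‖PowerSeries.coeff d (expHom a f)‖ ≤ invPrime l ^ d := by
  have h0 := invPrime_pos (l := l)
  rw [coeff_expHom a f le_rfl]
  refine IsUltrametricDist.norm_sum_le_of_forall_le_of_nonneg (by positivity) fun e _ => ?_
  rw [Algebra.smul_def, norm_mul]
  refine (mul_le_of_le_one_left (norm_nonneg _) (norm_algebraMap_padicInt_le_one _)).trans ?_
  exact (decayingSeries l).prod_mem
    (fun j _ => (decayingSeries l).pow_mem (norm_coeff_expSubOne_le (ha j)) (e j)) d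

theorem summable_norm_coeff_expLift {a : Fin n → PadicAlgCl l} (ha : ∀ j, ‖a j‖ ≤ invPrime l ^ 2)
    (f : R l n) : Summable fun d => ‖PowerSeries.coeff d (expLift a f)‖ := by
  induction f using TensorProduct.induction_on with
  | zero => simp
  | add f g hf hg =>
    refine Summable.of_nonneg_of_le (fun _ => norm_nonneg _) (fun d => ?_) (hf.add hg)
    rw [map_add, map_add]
    exact norm_add_le _ _
  | tmul c f =>
    have h : Summable fun d => ‖c‖ * invPrime l ^ d :=
      (summable_geometric_of_lt_one invPrime_pos.le invPrime_lt_one).mul_left _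
    refine Summable.of_nonneg_of_le (fun _ => norm_nonneg _) (fun d => ?_) h
    rw [expLift_tmul, PowerSeries.coeff_smul, smul_eq_mul, norm_mul]
    exact mul_le_mul_of_nonneg_left (norm_coeff_expHom_le ha f d) (norm_nonneg c)

theorem coeff_expHom_mem {a : Fin n → PadicAlgCl l} {K : IntermediateField ℚ_[l] (PadicAlgCl l)}
    (ha : ∀ j, a j ∈ K) (f : MvPowerSeries (Fin n) ℤ_[l]) (d : ℕ) :
    PowerSeries.coeff d (expHom a f) ∈ K := by
  have : IsScalarTower ℤ_[l] ℚ_[l] K := inferInstance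
  let a' : Fin n → K := fun j => ⟨a j, ha j⟩
  let v : K →ₐ[ℤ_[l]] PadicAlgCl l := K.val.restrictScalars ℤ_[l]
  have h := map_expHom v a' f
  have h2 : (fun j => v (a' j)) = a := rfl
  rw [h2] at h
  rw [← h, PowerSeries.coeff_map]
  exact (PowerSeries.coeff d (expHom a' f)).2

/-- `Λ` is not complete, but its finite-dimensional subspaces over `ℚ_l` are, so series are summed
inside one of them. -/
theorem summable_of_mem_finiteDimensional {V : Submodule ℚ_[l] (PadicAlgCl l)}
    [FiniteDimensional ℚ_[l] V] {x : ℕ → PadicAlgCl l} (hx : ∀ d, x d ∈ V)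
    (hs : Summable fun d => ‖x d‖) : Summable x := by
  have : CompleteSpace V := FiniteDimensional.complete ℚ_[l] V
  have h : Summable fun d => (⟨x d, hx d⟩ : V) := Summable.of_norm hs
  exact h.map V.subtype continuous_subtype_val

theorem summable_coeff_expLift {a : Fin n → PadicAlgCl l} (ha : ∀ j, ‖a j‖ ≤ invPrime l ^ 2)
    (f : R l n) : Summable fun d => PowerSeries.coeff d (expLift a f) := by
  induction f using TensorProduct.induction_on with
  | zero => simp
  | add f g hf hg => simpa using hf.add hg
  | tmul c f =>
    simp only [expLift_tmul, PowerSeries.coeff_smul]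
    refine Summable.const_smul c ?_
    -- With the scalar `c` pulled out, all coefficients lie in the finite extension generated by the
    -- algebraic numbers `a j` over `ℚ_l`.
    let K := IntermediateField.adjoin ℚ_[l] (Set.range a)
    have : FiniteDimensional ℚ_[l] K := IntermediateField.finiteDimensional_adjoin fun x _ =>
      (Algebra.IsAlgebraic.isAlgebraic x).isIntegral
    have : FiniteDimensional ℚ_[l] (Subalgebra.toSubmodule K.toSubalgebra) := this
    refine summable_of_mem_finiteDimensional (V := Subalgebra.toSubmodule K.toSubalgebra)
      (coeff_expHom_mem (K := K) (fun j => IntermediateField.subset_adjoin _ _ ⟨j, rfl⟩) f) ?_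
    simpa [expLift_tmul] using summable_norm_coeff_expLift ha (1 ⊗ₜ f)

/-- The point of `Spec R_n` with logarithmic coordinates `a`, for `a` close to zero. -/
def expPoint (a : Fin n → PadicAlgCl l) (ha : ∀ j, ‖a j‖ ≤ invPrime l ^ 2) :
    R l n →ₐ[PadicAlgCl l] PadicAlgCl l :=
  AlgHom.ofLinearMap
    { toFun := fun f => ∑' d, PowerSeries.coeff d (expLift a f)
      map_add' := fun f g => by
        simp only [map_add]
        exact (summable_coeff_expLift ha f).tsum_add (summable_coeff_expLift ha g)
      map_smul' := fun c f => by
        simp only [map_smul, RingHom.id_apply]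
        exact (summable_coeff_expLift ha f).tsum_const_smul c }
    (by
      change ∑' d, PowerSeries.coeff d (expLift a 1) = 1
      rw [map_one, tsum_eq_single 0 fun d hd => by rw [PowerSeries.coeff_one, if_neg hd]]
      simp)
    (fun f g => by
      change ∑' d, PowerSeries.coeff d (expLift a (f * g)) =
        (∑' d, PowerSeries.coeff d (expLift a f)) * ∑' d, PowerSeries.coeff d (expLift a g)
      simp only [map_mul, PowerSeries.coeff_mul]
      -- Cauchy product; without completeness, summability is supplied alongside summability of the
      -- norms.
      exact (tsum_mul_tsum_eq_tsum_sum_antidiagonal_of_summable_norm'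
        (summable_norm_coeff_expLift ha f) (summable_coeff_expLift ha f)
        (summable_norm_coeff_expLift ha g) (summable_coeff_expLift ha g)).symm)

theorem expPoint_apply (a : Fin n → PadicAlgCl l) (ha : ∀ j, ‖a j‖ ≤ invPrime l ^ 2) (f : R l n) :
    expPoint a ha f = ∑' d, PowerSeries.coeff d (expLift a f) := rfl

variable (l) in
/-- The sum of the exponential series. -/
def padicExp (z : PadicAlgCl l) : PadicAlgCl l :=
  ∑' d, PowerSeries.coeff d (PowerSeries.rescale z (PowerSeries.exp (PadicAlgCl l)))

theorem expPoint_groupLike (a : Fin n → PadicAlgCl l) (ha : ∀ j, ‖a j‖ ≤ invPrime l ^ 2)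
    (v : Lattice l n) : expPoint a ha (1 ⊗ₜ groupLike v) = padicExp l (∑ j, v j • a j) := by
  rw [expPoint_apply, expLift_tmul, one_smul, expHom_groupLike, padicExp]

theorem norm_sum_smul_le {a : Fin n → PadicAlgCl l} (ha : ∀ j, ‖a j‖ ≤ invPrime l ^ 2)
    (v : Lattice l n) : ‖∑ j, v j • a j‖ ≤ invPrime l ^ 2 := by
  have h0 := invPrime_pos (l := l)
  refine IsUltrametricDist.norm_sum_le_of_forall_le_of_nonneg (by positivity) fun j _ => ?_
  rw [Algebra.smul_def, norm_mul]
  exact (mul_le_of_le_one_left (norm_nonneg _) (norm_algebraMap_padicInt_le_one _)).trans (ha j)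

theorem summable_padicExp {z : PadicAlgCl l} (hz : ‖z‖ ≤ invPrime l ^ 2) :
    Summable fun d =>
      PowerSeries.coeff d (PowerSeries.rescale z (PowerSeries.exp (PadicAlgCl l))) := by
  have h := summable_coeff_expLift (n := 1) (a := fun _ => z) (fun _ => hz)
    (1 ⊗ₜ groupLike fun _ => 1)
  simpa [expLift_tmul, expHom_groupLike] using h

/-- By the ultrametric inequality the tail from degree two on is at most its largest term, so `z`
dominates it. This yields both continuity at `0` and `eq_zero_of_padicExp_eq_one`. -/
theorem norm_padicExp_sub_le {z : PadicAlgCl l} (hz : ‖z‖ ≤ invPrime l ^ 2) :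
    ‖padicExp l z - 1 - z‖ ≤ ‖z‖ * invPrime l := by
  have h0 := invPrime_pos (l := l)
  have hs := summable_padicExp hz
  rw [padicExp, ← hs.sum_add_tsum_nat_add 2]
  have h1 : ∑ d ∈ Finset.range 2,
      PowerSeries.coeff d (PowerSeries.rescale z (PowerSeries.exp (PadicAlgCl l))) = 1 + z := by
    simp [Finset.sum_range_succ, PowerSeries.coeff_rescale, PowerSeries.coeff_exp]
  rw [h1, sub_sub, add_sub_cancel_left]
  refine IsUltrametricDist.norm_tsum_le_of_forall_le_of_nonneg (by positivity) fun d => ?_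
  refine (norm_coeff_rescale_exp_le hz (d + 1)).trans ?_
  rw [pow_succ]
  gcongr
  exact mul_le_of_le_one_left h0.le (pow_le_one₀ h0.le invPrime_lt_one.le)

theorem norm_padicExp_sub_one_le {z : PadicAlgCl l} (hz : ‖z‖ ≤ invPrime l ^ 2) :
    ‖padicExp l z - 1‖ ≤ 2 * ‖z‖ := by
  have h1 := norm_padicExp_sub_le hz
  have h2 : ‖z‖ * invPrime l ≤ ‖z‖ := mul_le_of_le_one_right (norm_nonneg z) invPrime_lt_one.le
  have h3 := norm_add_le (padicExp l z - 1 - z) z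
  rw [sub_add_cancel] at h3
  linarith

theorem eq_zero_of_padicExp_eq_one {z : PadicAlgCl l} (hz : ‖z‖ ≤ invPrime l ^ 2)
    (h : padicExp l z = 1) : z = 0 := by
  by_contra hz0
  have h1 := norm_padicExp_sub_le hz
  rw [h, sub_self, zero_sub, norm_neg] at h1
  exact absurd (mul_lt_of_lt_one_right (norm_pos_iff.2 hz0) invPrime_lt_one) (not_lt.2 h1)

theorem padicExp_add (a : Fin n → PadicAlgCl l) (ha : ∀ j, ‖a j‖ ≤ invPrime l ^ 2)
    (v w : Lattice l n) : padicExp l (∑ j, (v + w) j • a j) =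
      padicExp l (∑ j, v j • a j) * padicExp l (∑ j, w j • a j) := by
  rw [← expPoint_groupLike a ha v, ← expPoint_groupLike a ha w, ← map_mul, expPoint_apply, map_mul,
    expLift_tmul, expLift_tmul, one_smul, one_smul, expHom_groupLike, expHom_groupLike,
    PowerSeries.exp_mul_exp_eq_exp_add, ← Finset.sum_add_distrib, padicExp]
  simp only [Pi.add_apply, add_smul]

theorem padicExp_zero : padicExp l 0 = 1 := by
  have h0 : ‖(0 : PadicAlgCl l)‖ ≤ invPrime l ^ 2 := by
    rw [norm_zero]; have := invPrime_pos (l := l); positivity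
  have := norm_padicExp_sub_one_le h0
  rw [norm_zero, mul_zero] at this
  exact sub_eq_zero.1 (norm_le_zero_iff.1 this)

/-- The homomorphism `v ↦ exp (∑ v_j a_j)`. -/
def expMonoidHom (a : Fin n → PadicAlgCl l) (ha : ∀ j, ‖a j‖ ≤ invPrime l ^ 2) :
    Multiplicative (Lattice l n) →* PadicAlgCl l where
  toFun v := padicExp l (∑ j, v.toAdd j • a j)
  map_one' := by simp [padicExp_zero]
  map_mul' v w := padicExp_add a ha v.toAdd w.toAdd

theorem continuous_expMonoidHom_toHomUnits (a : Fin n → PadicAlgCl l)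
    (ha : ∀ j, ‖a j‖ ≤ invPrime l ^ 2) : Continuous (expMonoidHom a ha).toHomUnits := by
  -- For a homomorphism continuity at `1` suffices, and the units of a normed field carry the
  -- subspace topology.
  apply continuous_of_continuousAt_one
  rw [Units.isEmbedding_val₀.isInducing.continuousAt_iff, ContinuousAt]
  have h1 : Filter.Tendsto (fun v : Multiplicative (Lattice l n) => 2 * ‖∑ j, v.toAdd j • a j‖)
      (nhds 1) (nhds 0) := by
    have hc : Continuous fun v : Lattice l n => 2 * ‖∑ j, v j • a j‖ := by
      simp only [Algebra.smul_def, IsScalarTower.algebraMap_apply ℤ_[l] ℚ_[l] (PadicAlgCl l)]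
      have h2 : Continuous (algebraMap ℚ_[l] (PadicAlgCl l)) := continuous_algebraMap _ _
      have h3 : Continuous (algebraMap ℤ_[l] ℚ_[l]) := continuous_subtype_val
      fun_prop
    have := (hc.comp continuous_toAdd).tendsto (1 : Multiplicative (Lattice l n))
    rw [Function.comp_apply, toAdd_one] at this
    simpa using! this
  rw [tendsto_iff_norm_sub_tendsto_zero]
  refine squeeze_zero (fun _ => norm_nonneg _) (fun v => ?_) h1
  have : (Units.val ∘ ⇑(expMonoidHom a ha).toHomUnits) 1 = 1 := by simp
  rw [this]
  exact norm_padicExp_sub_one_le (norm_sum_smul_le ha v.toAdd)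

/-- The continuous character with logarithmic coordinates `a`, for `a` close to zero. -/
def expCharacter (a : Fin n → PadicAlgCl l) (ha : ∀ j, ‖a j‖ ≤ invPrime l ^ 2) : Character l n where
  toMonoidHom := (expMonoidHom a ha).toHomUnits
  continuous_toFun := continuous_expMonoidHom_toHomUnits a ha

theorem expCharacter_apply (a : Fin n → PadicAlgCl l) (ha : ∀ j, ‖a j‖ ≤ invPrime l ^ 2)
    (v : Multiplicative (Lattice l n)) :
    (expCharacter a ha v : PadicAlgCl l) = padicExp l (∑ j, v.toAdd j • a j) := rfl

theorem expCharacter_zpow_apply (a : Fin n → PadicAlgCl l) (ha : ∀ j, ‖a j‖ ≤ invPrime l ^ 2)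
    (m : ℤ) (v : Multiplicative (Lattice l n)) :
    ((expCharacter a ha ^ m) v : PadicAlgCl l) = padicExp l (∑ j, v.toAdd j • (m • a) j) := by
  have h : (expCharacter a ha ^ m) v = expCharacter a ha (v ^ m) := by
    let evalHom : Character l n →* (PadicAlgCl l)ˣ :=
      { toFun := fun χ => χ v, map_one' := rfl, map_mul' := fun _ _ => rfl }
    rw [map_zpow]
    exact map_zpow evalHom _ m
  rw [h, expCharacter_apply]
  congr 1
  refine Finset.sum_congr rfl fun j _ => ?_
  rw [toAdd_zpow, Pi.smul_apply, Pi.smul_apply, smul_assoc, smul_comm]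

theorem norm_zsmul_le {a : Fin n → PadicAlgCl l} {r : ℝ} (ha : ∀ j, ‖a j‖ ≤ r) (m : ℤ)
    (j : Fin n) : ‖(m • a) j‖ ≤ r := by
  rw [Pi.smul_apply, zsmul_eq_mul, norm_mul]
  exact (mul_le_of_le_one_left (norm_nonneg _)
    (IsUltrametricDist.norm_intCast_le_one _ m)).trans (ha j)

theorem corresponds_expCharacter_zpow (a : Fin n → PadicAlgCl l)
    (ha : ∀ j, ‖a j‖ ≤ invPrime l ^ 2) (m : ℤ) :
    Corresponds (expCharacter a ha ^ m) (expPoint (m • a) (norm_zsmul_le ha m)) := fun v => by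
  rw [expPoint_groupLike, expCharacter_zpow_apply]
  rfl

/-- If the `m`-th power is trivial, its value at the `i`-th basis vector gives `exp (m a_i) = 1`,
hence `m a_i = 0` for every `i`. -/
theorem not_isOfFinOrder_expCharacter {a : Fin n → PadicAlgCl l} (ha0 : a ≠ 0)
    (ha : ∀ j, ‖a j‖ ≤ invPrime l ^ 2) : ¬ IsOfFinOrder (expCharacter a ha) := by
  rw [isOfFinOrder_iff_pow_eq_one]
  rintro ⟨m, hm, h⟩
  apply ha0
  funext i
  have h1 := expCharacter_zpow_apply a ha m (Multiplicative.ofAdd (Pi.single i 1))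
  rw [zpow_natCast, h] at h1
  have h2 := eq_zero_of_padicExp_eq_one
    (norm_sum_smul_le (norm_zsmul_le ha m) (Pi.single i 1)) h1.symm
  rw [Finset.sum_eq_single i (fun j _ hj => by simp [Pi.single_eq_of_ne hj]) (by simp)] at h2
  simpa [hm.ne'] using h2

theorem aeval_smul_logComponent (c : PadicAlgCl l) (a : Fin n → PadicAlgCl l) (d : ℕ) (f : R l n) :
    MvPolynomial.aeval (c • a) (logComponent d f) =
      c ^ d * MvPolynomial.aeval a (logComponent d f) := by
  have h := isHomogeneous_logComponent d f
  rw [MvPolynomial.aeval_def, MvPolynomial.aeval_def, MvPolynomial.eval₂_eq',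
    MvPolynomial.eval₂_eq', Finset.mul_sum]
  refine Finset.sum_congr rfl fun e he => ?_
  have hd : ∑ j, e j = d := by
    have := h (MvPolynomial.mem_support_iff.1 he)
    rw [← Finsupp.degree_eq_sum, Finsupp.degree_eq_weight_one]
    exact this
  simp only [Pi.smul_apply, smul_eq_mul, mul_pow, Finset.prod_mul_distrib,
    Finset.prod_pow_eq_pow_sum, hd]
  ring

theorem exists_infinite_subgroup {I : Ideal (R l n)} {a : Fin n → PadicAlgCl l} (ha0 : a ≠ 0)
    (ha : ∀ f ∈ I, ∀ d, MvPolynomial.aeval a (logComponent d f) = 0) :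
    ∃ A : Subgroup (Character l n), (A : Set (Character l n)).Infinite ∧
      (A : Set (Character l n)) ⊆ spectrumPoints I := by
  -- Vanishing of homogeneous components is invariant under scaling, so `a` may be moved into the
  -- domain of convergence.
  obtain ⟨c, hc0, hc⟩ : ∃ c : PadicAlgCl l, c ≠ 0 ∧ ∀ j, ‖(c • a) j‖ ≤ invPrime l ^ 2 := by
    have h0 : 0 < invPrime l ^ 2 := pow_pos invPrime_pos 2
    have h2 : 0 < 1 + ∑ j, ‖a j‖ :=
      add_pos_of_pos_of_nonneg one_pos (Finset.sum_nonneg fun j _ => norm_nonneg (a j))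
    obtain ⟨c, hc0, hc⟩ := NormedField.exists_norm_lt (PadicAlgCl l) (div_pos h0 h2)
    refine ⟨c, norm_pos_iff.1 hc0, fun j => ?_⟩
    have h1 : ‖a j‖ ≤ 1 + ∑ j, ‖a j‖ :=
      (Finset.single_le_sum (f := fun j => ‖a j‖) (fun _ _ => norm_nonneg _)
        (Finset.mem_univ j)).trans (by linarith)
    rw [Pi.smul_apply, smul_eq_mul, norm_mul]
    calc ‖c‖ * ‖a j‖ ≤ invPrime l ^ 2 / (1 + ∑ j, ‖a j‖) * (1 + ∑ j, ‖a j‖) :=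
          mul_le_mul hc.le h1 (norm_nonneg _) (div_pos h0 h2).le
      _ = _ := div_mul_cancel₀ _ h2.ne'
  refine ⟨Subgroup.zpowers (expCharacter (c • a) hc), ?_, ?_⟩
  · exact infinite_zpowers.2 (not_isOfFinOrder_expCharacter (smul_ne_zero hc0 ha0) hc)
  · rintro _ ⟨m, rfl⟩
    refine ⟨_, corresponds_expCharacter_zpow (c • a) hc m, fun f hf => ?_⟩
    rw [expPoint_apply]
    refine (tsum_congr fun d => ?_).trans tsum_zero
    rw [coeff_expLift, ← Int.cast_smul_eq_zsmul (PadicAlgCl l), aeval_smul_logComponent,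
      aeval_smul_logComponent, ha f hf d, mul_zero, mul_zero]

theorem action_mem_of_image_eq {F : Lattice l n →ₗ[ℤ_[l]] Lattice l n} {I : Ideal (R l n)}
    (h : action F '' (I : Set (R l n)) = I) : ∀ f ∈ I, action F f ∈ I := fun f hf => by
  have : action F f ∈ action F '' (I : Set (R l n)) := ⟨f, hf, rfl⟩
  rwa [h] at this

theorem groupLike_single (i : Fin n) :
    groupLike (Pi.single i 1 : Lattice l n) = 1 + MvPowerSeries.X i := by
  classical
  have hone : ∀ m : ℕ, Ring.choose (1 : ℤ_[l]) m = ((1 : ℕ).choose m : ℤ_[l]) := fun m => by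
    rw [← Ring.choose_natCast, Nat.cast_one]
  ext d
  have h : MvPowerSeries.coeff d (groupLike (Pi.single i 1 : Lattice l n)) =
      ∏ j, Ring.choose ((Pi.single i 1 : Lattice l n) j) (d j) := rfl
  rw [h, map_add, MvPowerSeries.coeff_one, MvPowerSeries.coeff_X]
  by_cases hd : ∃ j, j ≠ i ∧ d j ≠ 0
  · obtain ⟨j, hj, hdj⟩ := hd
    rw [Finset.prod_eq_zero (Finset.mem_univ j)
      (by rw [Pi.single_eq_of_ne hj, Ring.choose_zero_pos _ (Nat.pos_of_ne_zero hdj)]),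
      if_neg, if_neg, add_zero]
    · rintro rfl
      exact hdj (Finsupp.single_eq_of_ne hj)
    · rintro rfl
      exact hdj rfl
  · push Not at hd
    have hds : d = Finsupp.single i (d i) := by
      ext j
      by_cases hj : j = i
      · subst hj; simp
      · rw [hd j hj, Finsupp.single_eq_of_ne hj]
    rw [Finset.prod_eq_single i (fun j _ hj => by rw [hd j hj, Ring.choose_zero_right])
      (by simp), Pi.single_eq_same, hone, hds]
    rcases d i with _ | _ | m
    · simp [eq_comm (a := (0 : Fin n →₀ ℕ))]
    · simp
    · simp [Nat.choose_eq_zero_of_lt]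

theorem maxIdeal_le_ker {ψ : R l n →ₐ[PadicAlgCl l] PadicAlgCl l} (hψ : Corresponds 1 ψ) :
    maxIdeal l n ≤ RingHom.ker ψ := by
  refine Ideal.span_le.2 ?_
  rintro _ ⟨i, rfl⟩
  have h := hψ (Pi.single i 1)
  rw [groupLike_single, TensorProduct.tmul_add, map_add, ← Algebra.TensorProduct.one_def,
    map_one] at h
  simpa using h

/-- A point over the trivial character kills every `t_i`. As each `f` is a constant `c` modulo `m`,
it sends `f` to `c`, so its kernel is `m`. -/
theorem le_maxIdeal_of_one_mem_spectrumPoints {I : Ideal (R l n)}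
    (h : (1 : Character l n) ∈ spectrumPoints I) : I ≤ maxIdeal l n ∧ maxIdeal l n ≠ ⊤ := by
  obtain ⟨ψ, hψ, hI⟩ := h
  have hm := maxIdeal_le_ker hψ
  refine ⟨fun f hf => ?_, fun htop => ?_⟩
  · obtain ⟨c, hc⟩ := exists_sub_algebraMap_mem_maxIdeal f
    have h1 : ψ (f - algebraMap _ _ c) = 0 := hm hc
    rw [map_sub, hI f hf, AlgHom.commutes, zero_sub, neg_eq_zero] at h1
    have h2 : c = 0 := h1
    simpa [h2] using hc
  · have h1 : (1 : R l n) ∈ RingHom.ker ψ := hm (htop ▸ Submodule.mem_top)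
    rw [RingHom.mem_ker, map_one] at h1
    exact one_ne_zero h1

end CharacterTorus

end

theorem proposition3 (l : ℕ) [Fact l.Prime] (p : ℕ) (hp : p.Prime) (hpl : p ≠ l) (n w : ℕ)
    (hw : 0 < w)
    (F : CharacterTorus.Lattice l n ≃ₗ[ℤ_[l]] CharacterTorus.Lattice l n)
    (hF : ∀ α : PadicAlgCl l,
      Polynomial.aeval α (F : CharacterTorus.Lattice l n →ₗ[ℤ_[l]]
        CharacterTorus.Lattice l n).charpoly = 0 → IsWeilNumber p w α)
    (I : Ideal (CharacterTorus.R l n)) (hI : I.IsPrime)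
    (hIF : CharacterTorus.action (F : CharacterTorus.Lattice l n →ₗ[ℤ_[l]]
        CharacterTorus.Lattice l n) '' (I : Set (CharacterTorus.R l n)) = I)
    (h1 : (1 : CharacterTorus.Character l n) ∈ CharacterTorus.spectrumPoints I) :
    I = CharacterTorus.maxIdeal l n ∨
      ∃ A : Subgroup (CharacterTorus.Character l n),
        (A : Set (CharacterTorus.Character l n)).Infinite ∧
        (A : Set (CharacterTorus.Character l n)) ⊆ CharacterTorus.spectrumPoints I := by
  obtain ⟨hIm, hm⟩ := CharacterTorus.le_maxIdeal_of_one_mem_spectrumPoints h1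
  obtain ⟨W, hW⟩ := CharacterTorus.exists_weightSystem (k := PadicAlgCl l) hp.one_lt hw
  refine (CharacterTorus.exists_tangent_vector_or_maxIdeal_le hI hIm hm).imp
    (fun h => le_antisymm hIm h) ?_
  rintro ⟨a, ha0, ha⟩
  refine CharacterTorus.exists_infinite_subgroup ha0 fun f hf d => ?_
  -- The tangent vector `a` is only known to annihilate leading forms; the weight argument replaces
  -- `f` by some `g` in `I` whose leading form is the degree `d` component of `f`.
  obtain ⟨g, hg, hgd, hge⟩ := CharacterTorus.exists_isolate_logComponent W _
    (fun α hα => hW α (hF α hα)) (CharacterTorus.action_mem_of_image_eq hIF) hf d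
  rw [← hgd]
  exact ha d g hg hge
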